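/- For nonnegative integers $m,n$ let $\Gamma_{m,n}$ be the directed acyclic graph with vertices $v_{i,j}$ ($0\le i\le m$, $0\le j\le n$) and all edges of the forms $(v_{i,j},v_{i+1,j})$, $(v_{i,j},v_{i,j+1})$ and $(v_{i,j},v_{i+1,j+1})$ between these vertices. For an edge weighting $w\colon E(\Gamma_{m,n})\to\mathbb{Z}\cup\{-\infty\}$, the length of a path is the sum of the weights of its edges. Put $N=\max\{m,n\}$, and let $\log$ denote the logarithm to base $2$. The computational model is a unit-cost RAM with words of $\mathrm{O}(\log N)$ bits. Its input is read-only and consists of $m$, $n$ and a constant-time oracle for $w$ (one step per query of the weight of an edge); its output is write-only; and its space consumption is the number of bits of its additional readable and writable memory. There is a single program for this RAM such that for every constant $c$ there is a constant $C$, depending only on $c$, with the following property. Let $m,n\ge 0$ with $N=\max\{m,n\}\ge 2$, and let $w\colon E(\Gamma_{m,n})\to\mathbb{Z}\cup\{-\infty\}$ be such that each finite weight can be represented in at most $c\log N$ bits. Then the program computes the maximum length (in $\mathbb{Z}\cup\{-\infty\}$) of a path from $v_{0,0}$ to $v_{m,n}$ in at most $C N^{3}$ steps, with words of at most $C\log N$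 bits, and using at most $C\cdot\frac{N\log^{1.5}N}{2^{\sqrt{\log N}}}$ bits of space. -/

import Mathlib

/-! ### The grid graph `Γ_{m,n}`, its edge weightings and longest paths -/

/-- The vertices `v_{i,j}`, `0 ≤ i ≤ m`, `0 ≤ j ≤ n`, of the grid graph `Γ_{m,n}`. -/
@[ext]
structure GridVertex (m n : ℕ) where
  /-- the first index `i` -/
  i : Fin (m + 1)
  /-- the second index `j` -/
  j : Fin (n + 1)

/-- The three kinds of edges of the grid graph. -/
inductive GridDir
  /-- `(v_{i,j}, v_{i+1,j})` -/
  | fst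
  /-- `(v_{i,j}, v_{i,j+1})` -/
  | snd
  /-- `(v_{i,j}, v_{i+1,j+1})` -/
  | diag

/-- Increment of the first index along an edge of the given kind. -/
def GridDir.di : GridDir → ℕ
  | fst => 1
  | snd => 0
  | diag => 1

/-- Increment of the second index along an edge of the given kind. -/
def GridDir.dj : GridDir → ℕ
  | fst => 0
  | snd => 1
  | diag => 1

/-- `(u, v)` is an edge of `Γ_{m,n}`. -/
def GridEdge {m n : ℕ} (u v : GridVertex m n) : Prop :=
  ∃ d : GridDir, (v.i : ℕ) = u.i + d.di ∧ (v.j : ℕ) = u.j + d.dj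

/-- The directed graph `Γ_{m,n}`: there is exactly one arrow `u ⟶ v` for each edge `(u, v)`, and none otherwise, so that
`Quiver.Path u v` is the type of directed paths from `u` to `v` (the graph is acyclic). -/
instance GridVertex.instQuiver (m n : ℕ) : Quiver (GridVertex m n) where
  Hom u v := PLift (GridEdge u v)

/-- Edge weightings `w : E(Γ_{m,n}) → ℤ ∪ {-∞}`. -/
abbrev GridWeight (m n : ℕ) : Type :=
  ∀ u v : GridVertex m n, GridEdge u v → WithBot ℤ

/-- The set of the lengths (sums of the edge weights) of all paths from `u` to `v`. -/
def GridWeight.pathLengths {m n : ℕ} (w : GridWeight m n) (u v : GridVertex m n) :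
    Set (WithBot ℤ) :=
  {x | ∃ p : Quiver.Path u v, p.addWeight (fun {a b} (e : a ⟶ b) => w a b (PLift.down e)) = x}

/-- The number of bits in the signed binary representation of an integer: a sign bit followed by
the binary digits of the absolute value. -/
def Int.bitLength (x : ℤ) : ℕ := 1 + x.natAbs.size

/-- Every finite edge weight can be represented in at most `b` bits. -/
def GridWeight.FitsIn {m n : ℕ} (w : GridWeight m n) (b : ℝ) : Prop :=
  ∀ (u v : GridVertex m n) (e : GridEdge u v) (x : ℤ), w u v e = (x : WithBot ℤ) →
    (x.bitLength : ℝ) ≤ b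

/-- The oracle: the weight of the edge of kind `d` that starts at `v_{i,j}`, or `none` if there is
no such edge in `Γ_{m,n}`. -/
def GridWeight.oracle {m n : ℕ} (w : GridWeight m n) (d : GridDir) (i j : ℤ) :
    Option (WithBot ℤ) :=
  if h : 0 ≤ i ∧ 0 ≤ j ∧ i.toNat + d.di ≤ m ∧ j.toNat + d.dj ≤ n then
    some (w ⟨⟨i.toNat, by omega⟩, ⟨j.toNat, by omega⟩⟩
      ⟨⟨i.toNat + d.di, by omega⟩, ⟨j.toNat + d.dj, by omega⟩⟩ ⟨d, rfl, rfl⟩)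
  else none

/-! ### The random access machine

A unit-cost random access machine with read-only input, a readable and writable working memory
that consists of `S` words of `W` bits each, and a write-only output. It has no other registers:
every value that it keeps, apart from the position in the fixed program, is in the working memory.
-/

/-- Instructions. An argument called `a`, `b`, `i`, `j` or `dst` is the address of a word of the
working memory, `k` is a constant, and `l` is a position in the program. -/
inductive RAMInstr
  /-- `M[dst] := k` -/
  | const (dst : ℕ) (k : ℤ)
  /-- `M[dst] := M[a] + M[b]` -/
  | add (dst a b : ℕ)
  /-- `M[dst] := M[a] - M[b]` -/
  | sub (dst a b : ℕ)
  /-- `M[dst] := M[a] * M[b]` -/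
  | mul (dst a b : ℕ)
  /-- `M[dst] := ⌊M[a] / M[b]⌋`; fails if `M[b] = 0` -/
  | div (dst a b : ℕ)
  /-- `M[dst] := M[M[a]]` (indirect read) -/
  | load (dst a : ℕ)
  /-- `M[M[a]] := M[b]` (indirect write) -/
  | store (a b : ℕ)
  /-- continue at position `l` -/
  | jump (l : ℕ)
  /-- continue at position `l` if `M[a] ≤ M[b]` -/
  | jumpLE (a b l : ℕ)
  /-- `M[dst] := m`, read from the input -/
  | readM (dst : ℕ)
  /-- `M[dst] := n`, read from the input -/
  | readN (dst : ℕ)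
  /-- ask the oracle for the weight of the edge of kind `d` that starts at `v_{M[i],M[j]}`:
  if it is an integer, write it to `M[dst]`, and if it is `-∞`, continue at position `l` -/
  | query (d : GridDir) (i j dst l : ℕ)
  /-- output the integer `M[a]` and halt -/
  | outInt (a : ℕ)
  /-- output `-∞` and halt -/
  | outBot

/-- A program is a fixed finite list of instructions. -/
abbrev RAMProgram : Type := List RAMInstr

/-- A configuration: the position in the program and the contents of the working memory. -/
structure RAMConfig where
  /-- the position in the program -/
  pc : ℕ
  /-- the contents of the working memory; only the words at addresses below `S` exist -/
  mem : ℕ → ℤ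

/-- The result of executing one instruction. -/
inductive RAMOutcome
  /-- the computation goes on -/
  | next (c : RAMConfig)
  /-- the machine halts with an output -/
  | halt (x : WithBot ℤ)
  /-- the instruction cannot be executed: an address outside of the working memory, a value that
  does not fit in a word, a division by zero, a query for a non-existent edge, or a position
  outside of the program -/
  | fail

/-- Read the word at address `a`. -/
def RAMConfig.read (c : RAMConfig) (S : ℕ) (a : ℕ) : Option ℤ :=
  if a < S then some (c.mem a) else none

/-- Read the word at address `a` as an address. -/
def RAMConfig.readAddr (c : RAMConfig) (S : ℕ) (a : ℕ) : Option ℕ :=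
  (c.read S a).bind fun x => if 0 ≤ x then some x.toNat else none

/-- Write `x` to the word at address `dst` and go on to the next position. -/
def RAMConfig.write (c : RAMConfig) (S W : ℕ) (dst : ℕ) (x : ℤ) : Option RAMOutcome :=
  if dst < S ∧ x.bitLength ≤ W then
    some (.next { pc := c.pc + 1, mem := Function.update c.mem dst x })
  else none

/-- Continue at position `l`. -/
def RAMConfig.goto (c : RAMConfig) (l : ℕ) : RAMOutcome :=
  .next { c with pc := l }

/-- Execution of a single instruction (`none` if it fails) on the input `(m, n, w)`, with a working
memory of `S` words of `W` bits. -/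
def RAMInstr.exec {m n : ℕ} (w : GridWeight m n) (S W : ℕ) (c : RAMConfig) :
    RAMInstr → Option RAMOutcome
  | const dst k => c.write S W dst k
  | add dst a b => do
      let x ← c.read S a
      let y ← c.read S b
      c.write S W dst (x + y)
  | sub dst a b => do
      let x ← c.read S a
      let y ← c.read S b
      c.write S W dst (x - y)
  | mul dst a b => do
      let x ← c.read S a
      let y ← c.read S b
      c.write S W dst (x * y)
  | div dst a b => do
      let x ← c.read S a
      let y ← c.read S b
      if y = 0 then none else c.write S W dst (x.fdiv y)
  | load dst a => do
      let p ← c.readAddr S a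
      let x ← c.read S p
      c.write S W dst x
  | store a b => do
      let p ← c.readAddr S a
      let x ← c.read S b
      c.write S W p x
  | jump l => some (c.goto l)
  | jumpLE a b l => do
      let x ← c.read S a
      let y ← c.read S b
      some (c.goto (if x ≤ y then l else c.pc + 1))
  | readM dst => c.write S W dst m
  | readN dst => c.write S W dst n
  | query d i j dst l => do
      let x ← c.read S i
      let y ← c.read S j
      let z ← w.oracle d x y
      match z with
      | (z : ℤ) => c.write S W dst z
      | ⊥ => some (c.goto l)
  | outInt a => do
      let x ← c.read S a
      some (.halt (x : WithBot ℤ))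
  | outBot => some (.halt ⊥)

/-- One step of the program `P`. -/
def RAMProgram.step {m n : ℕ} (P : RAMProgram) (w : GridWeight m n) (S W : ℕ)
    (c : RAMConfig) : RAMOutcome :=
  match P[c.pc]? with
  | none => .fail
  | some I => (I.exec w S W c).getD .fail

/-- The output of `P`, started in the configuration `c`, if it halts without a failure within
`t` steps. -/
def RAMProgram.run {m n : ℕ} (P : RAMProgram) (w : GridWeight m n) (S W : ℕ) :
    ℕ → RAMConfig → Option (WithBot ℤ)
  | 0, _ => none
  | t + 1, c =>
    match P.step w S W c with
    | .next c' => RAMProgram.run P w S W t c'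
    | .halt x => some x
    | .fail => none

/-- The initial configuration: the first position of the program, and all words are `0`. -/
def RAMConfig.init : RAMConfig := { pc := 0, mem := fun _ => 0 }

/-- On the input `(m, n, w)`, the program `P` halts within `T` steps and outputs `x`, using a
working memory of `S` words of `W` bits each. -/
def RAMProgram.Computes {m n : ℕ} (P : RAMProgram) (w : GridWeight m n) (S W T : ℕ)
    (x : WithBot ℤ) : Prop :=
  P.run w S W T RAMConfig.init = some x

/-- `N * (log N) ^ 1.5 / 2 ^ √(log N)`, where `log` is the logarithm to base `2`. -/
noncomputable def lcsSpace (N : ℕ) : ℝ :=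
  N * (Real.logb 2 N) ^ (1.5 : ℝ) / (2 : ℝ) ^ √(Real.logb 2 N)

/-!
Divide the rows of the grid into `k` strips of height `h = ⌊N / k⌋ + 1` and the columns into `k`
segments of width `h`, where `k = 2 ^ l` and `l = ⌊√(log N)⌋`. The longest path lengths from a
set of start vertices in row `i` to the vertices of row `i'` form a max-plus linear operator
`stepRows` on rows of numbers. Being linear, it may be applied to one segment of a row at a time
(`stepRows_segments`), and it is causal: an entry depends only on the entries at
and to the left of its position.

The algorithm is a recursion in the style of Savitch. To add to the array of a target segment,
`2 ^ j` strips below, the contribution of the paths that start in a source segment, consider for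
`j > 0` all `k` segments of the row in the middle in turn, and compute recursively first an
array for the middle segment, then its contribution to the target. For `j = 0` a single strip is
processed column by column, which takes `O(N h)` time and one array of length `h` (`leaf_ok`).
Starting with `j = l`, this needs `l + O(1)` arrays of length `h`, that is
`O(√(log N) * N / 2 ^ √(log N))` words of `O(log N)` bits (`space_le`). The number of processed
strips is `(2 * k) ^ l = k * 2 ^ (l ^ 2) ≤ k * N`, so that the time is
`O(k * N * N * h) = O(N ^ 3)` (`mainTime_le_cube`).

The recursion has no stack: the current choices at all levels are kept in one record per level,
which is advanced like an odometer, and the arrays to be used for a strip are found by a search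
through the records. The correctness of this loop is proved by induction on `j` (`mainLoop_ok`).
The program is written with structured commands `Cmd` that are compiled to machine instructions,
and verified with the rules for the correctness statement `Ok`, which includes a time bound.
-/

/-! ### Structured commands -/

/-- Structured commands over the memory words of the machine. -/
inductive Cmd
  /-- straight-line code -/
  | op (l : List RAMInstr)
  /-- sequential composition -/
  | seq (c₁ c₂ : Cmd)
  /-- `if M[a] ≤ M[b] then c₁ else c₂` -/
  | ifLE (a b : ℕ) (c₁ c₂ : Cmd)
  /-- `while M[a] < M[b] do c` -/
  | whileLT (a b : ℕ) (c : Cmd)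
  /-- query the weight of an edge, continue with `c₁` if it is an integer and with `c₂` if it is
  `-∞` -/
  | query (d : GridDir) (i j dst : ℕ) (c₁ c₂ : Cmd)

infixr:60 " ;; " => Cmd.seq

namespace Cmd

/-- The number of instructions of the compiled command. -/
def len : Cmd → ℕ
  | op l => l.length
  | seq c₁ c₂ => c₁.len + c₂.len
  | ifLE _ _ c₁ c₂ => c₁.len + c₂.len + 2
  | whileLT _ _ c => c.len + 2
  | query _ _ _ _ c₁ c₂ => c₁.len + c₂.len + 2

/-- The compiled command, to be placed at position `o` of a program. -/
def code : Cmd → ℕ → List RAMInstr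
  | op l, _ => l
  | seq c₁ c₂, o => c₁.code o ++ c₂.code (o + c₁.len)
  | ifLE a b c₁ c₂, o =>
      .jumpLE a b (o + (c₂.len + 2)) :: (c₂.code (o + 1) ++
        .jump (o + (c₁.len + c₂.len + 2)) :: c₁.code (o + (c₂.len + 2)))
  | whileLT a b c, o => .jumpLE b a (o + (c.len + 2)) :: (c.code (o + 1) ++ [.jump o])
  | query d i j dst c₁ c₂, o =>
      .query d i j dst (o + (c₁.len + 2)) :: (c₁.code (o + 1) ++
        .jump (o + (c₁.len + c₂.len + 2)) :: c₂.code (o + (c₁.len + 2)))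

theorem length_code (c : Cmd) : ∀ o, (c.code o).length = c.len := by
  induction c <;> simp [code, len, *] <;> omega

/-- `if M[a] = M[b] then c₁ else c₂` -/
def ifEq (a b : ℕ) (c₁ c₂ : Cmd) : Cmd := ifLE a b (ifLE b a c₁ c₂) c₂

end Cmd

/-- `l` occurs in the program `P` at position `o`. -/
def RAMProgram.HasAt (P : RAMProgram) (o : ℕ) (l : List RAMInstr) : Prop :=
  ∃ p q, P = p ++ l ++ q ∧ p.length = o

theorem RAMProgram.HasAt.append {P : RAMProgram} {o : ℕ} {l₁ l₂ : List RAMInstr}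
    (h : P.HasAt o (l₁ ++ l₂)) : P.HasAt o l₁ ∧ P.HasAt (o + l₁.length) l₂ := by
  obtain ⟨p, q, rfl, rfl⟩ := h
  exact ⟨⟨p, l₂ ++ q, by simp, rfl⟩, ⟨p ++ l₁, q, by simp, by simp⟩⟩

theorem RAMProgram.HasAt.cons {P : RAMProgram} {o : ℕ} {I : RAMInstr} {l : List RAMInstr}
    (h : P.HasAt o (I :: l)) : P[o]? = some I ∧ P.HasAt (o + 1) l := by
  obtain ⟨p, q, rfl, rfl⟩ := h
  exact ⟨by simp, ⟨p ++ [I], q, by simp, by simp⟩⟩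

section Rules

variable {m n : ℕ} {w : GridWeight m n} {S W : ℕ}

/-- `P` goes from the configuration `c` to the configuration `c'` in exactly `s` steps. -/
def RAMProgram.Reaches (P : RAMProgram) (w : GridWeight m n) (S W s : ℕ) (c c' : RAMConfig) :
    Prop :=
  ∀ r, P.run w S W (s + r) c = P.run w S W r c'

theorem RAMProgram.Reaches.trans {P : RAMProgram} {s₁ s₂ : ℕ} {c₁ c₂ c₃ : RAMConfig}
    (h₁ : P.Reaches w S W s₁ c₁ c₂) (h₂ : P.Reaches w S W s₂ c₂ c₃) :
    P.Reaches w S W (s₁ + s₂) c₁ c₃ := fun r => by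
  rw [add_assoc, h₁, h₂]

theorem RAMProgram.reaches_one {P : RAMProgram} {c c' : RAMConfig} {I : RAMInstr}
    (hI : P[c.pc]? = some I) (h : I.exec w S W c = some (.next c')) :
    P.Reaches w S W 1 c c' := fun r => by
  rw [add_comm 1 r, RAMProgram.run, RAMProgram.step]
  simp [hI, h]

/-- The addresses that occur in a straight-line instruction are below `32`. -/
def RAMInstr.Below : RAMInstr → Bool
  | .const d _ => d < 32
  | .add d a b => d < 32 && a < 32 && b < 32
  | .sub d a b => d < 32 && a < 32 && b < 32
  | .mul d a b => d < 32 && a < 32 && b < 32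
  | .div d a b => d < 32 && a < 32 && b < 32
  | .load d a => d < 32 && a < 32
  | .store a b => a < 32 && b < 32
  | .readM d => d < 32
  | .readN d => d < 32
  | _ => false

/-- The weakest precondition of a straight-line instruction, for memories all of whose words fit
into `W` bits and instructions that address the first `32` words directly. -/
def RAMInstr.wp (m n S W : ℕ) : RAMInstr → ((ℕ → ℤ) → Prop) → (ℕ → ℤ) → Prop
  | .const d k, Q, μ => k.bitLength ≤ W ∧ Q (Function.update μ d k)
  | .add d a b, Q, μ => (μ a + μ b).bitLength ≤ W ∧ Q (Function.update μ d (μ a + μ b))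
  | .sub d a b, Q, μ => (μ a - μ b).bitLength ≤ W ∧ Q (Function.update μ d (μ a - μ b))
  | .mul d a b, Q, μ => (μ a * μ b).bitLength ≤ W ∧ Q (Function.update μ d (μ a * μ b))
  | .div d a b, Q, μ => μ b ≠ 0 ∧ ((μ a).fdiv (μ b)).bitLength ≤ W ∧
      Q (Function.update μ d ((μ a).fdiv (μ b)))
  | .load d a, Q, μ => ∃ p : ℕ, μ a = p ∧ p < S ∧ Q (Function.update μ d (μ p))
  | .store a b, Q, μ => ∃ p : ℕ, μ a = p ∧ p < S ∧ Q (Function.update μ p (μ b))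
  | .readM d, Q, μ => (m : ℤ).bitLength ≤ W ∧ Q (Function.update μ d m)
  | .readN d, Q, μ => (n : ℤ).bitLength ≤ W ∧ Q (Function.update μ d n)
  | _, _, _ => False

/-- The weakest precondition of straight-line code. -/
def wpList (m n S W : ℕ) : List RAMInstr → ((ℕ → ℤ) → Prop) → (ℕ → ℤ) → Prop
  | [], Q, μ => Q μ
  | I :: l, Q, μ => I.wp m n S W (wpList m n S W l Q) μ

/-- Total correctness with a time bound: started in the memory `μ` (all words of which fit into
`W` bits), the compiled command `c` is executed without a failure in at most `t` steps, and `Q`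
holds for the resulting memory. -/
def Ok (w : GridWeight m n) (S W : ℕ) (c : Cmd) (μ : ℕ → ℤ) (t : ℕ) (Q : (ℕ → ℤ) → Prop) : Prop :=
  (∀ a, (μ a).bitLength ≤ W) → ∀ (P : RAMProgram) (o : ℕ), P.HasAt o (c.code o) →
    ∃ s ≤ t, ∃ μ', (∀ a, (μ' a).bitLength ≤ W) ∧ Q μ' ∧
      P.Reaches w S W s ⟨o, μ⟩ ⟨o + c.len, μ'⟩

theorem Ok.mono {c : Cmd} {μ : ℕ → ℤ} {t t' : ℕ} {Q Q' : (ℕ → ℤ) → Prop}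
    (h : Ok w S W c μ t Q) (ht : t ≤ t') (hQ : ∀ μ', Q μ' → Q' μ') : Ok w S W c μ t' Q' := by
  intro hμ P o hP
  obtain ⟨s, hs, μ', hμ', hQ', hr⟩ := h hμ P o hP
  exact ⟨s, hs.trans ht, μ', hμ', hQ _ hQ', hr⟩

theorem Ok.seq {c₁ c₂ : Cmd} {μ : ℕ → ℤ} {t : ℕ} {Q : (ℕ → ℤ) → Prop} (t₁ t₂ : ℕ)
    (ht : t₁ + t₂ ≤ t) (h : Ok w S W c₁ μ t₁ fun μ' => Ok w S W c₂ μ' t₂ Q) :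
    Ok w S W (c₁ ;; c₂) μ t Q := by
  intro hμ P o hP
  obtain ⟨hP₁, hP₂⟩ := RAMProgram.HasAt.append hP
  rw [Cmd.length_code] at hP₂
  obtain ⟨s₁, hs₁, μ₁, hμ₁, h₁, hr₁⟩ := h hμ P o hP₁
  obtain ⟨s₂, hs₂, μ₂, hμ₂, h₂, hr₂⟩ := h₁ hμ₁ P _ hP₂
  exact ⟨s₁ + s₂, by omega, μ₂, hμ₂, h₂, by simpa [Cmd.len, add_assoc] using hr₁.trans hr₂⟩

theorem fits_update {μ : ℕ → ℤ} (hμ : ∀ a, (μ a).bitLength ≤ W) {x : ℤ}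
    (hx : x.bitLength ≤ W) (d : ℕ) : ∀ a, (Function.update μ d x a).bitLength ≤ W := fun a => by
  rw [Function.update_apply]; split_ifs <;> simp [hx, hμ]

theorem exec_of_wp (hS : 32 ≤ S) {I : RAMInstr} (hI : I.Below) {μ : ℕ → ℤ}
    {Q : (ℕ → ℤ) → Prop} (hμ : ∀ a, (μ a).bitLength ≤ W) (h : I.wp m n S W Q μ) (o : ℕ) :
    ∃ μ', (∀ a, (μ' a).bitLength ≤ W) ∧ Q μ' ∧
      I.exec w S W ⟨o, μ⟩ = some (.next ⟨o + 1, μ'⟩) := by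
  have key : ∀ d < 32, ∀ x : ℤ, x.bitLength ≤ W →
      RAMConfig.write ⟨o, μ⟩ S W d x = some (.next ⟨o + 1, Function.update μ d x⟩) :=
    fun d hd x hx => by simp [RAMConfig.write, hx, show d < S by omega]
  have rd : ∀ a < 32, RAMConfig.read ⟨o, μ⟩ S a = some (μ a) :=
    fun a ha => by simp [RAMConfig.read, show a < S by omega]
  cases I <;> simp only [RAMInstr.Below, Bool.and_eq_true, decide_eq_true_eq, Bool.false_eq_true]
    at hI
  case const d k =>
    exact ⟨_, fits_update hμ h.1 d, h.2, by simp [RAMInstr.exec, key d hI _ h.1]⟩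
  case add d a b =>
    exact ⟨_, fits_update hμ h.1 d, h.2, by
      simp [RAMInstr.exec, rd a (by omega), rd b (by omega), key d (by omega) _ h.1]⟩
  case sub d a b =>
    exact ⟨_, fits_update hμ h.1 d, h.2, by
      simp [RAMInstr.exec, rd a (by omega), rd b (by omega), key d (by omega) _ h.1]⟩
  case mul d a b =>
    exact ⟨_, fits_update hμ h.1 d, h.2, by
      simp [RAMInstr.exec, rd a (by omega), rd b (by omega), key d (by omega) _ h.1]⟩
  case div d a b =>
    exact ⟨_, fits_update hμ h.2.1 d, h.2.2, by
      simp [RAMInstr.exec, rd a (by omega), rd b (by omega), key d (by omega) _ h.2.1, h.1]⟩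
  case load d a =>
    obtain ⟨p, hp, hpS, hQ⟩ := h
    refine ⟨_, fits_update hμ (hμ p) d, hQ, ?_⟩
    have : RAMConfig.read ⟨o, μ⟩ S p = some (μ p) := by simp [RAMConfig.read, hpS]
    simp [RAMInstr.exec, RAMConfig.readAddr, rd a (by omega), hp, this, key d (by omega) _ (hμ p)]
  case store a b =>
    obtain ⟨p, hp, hpS, hQ⟩ := h
    refine ⟨_, fits_update hμ (hμ b) p, hQ, ?_⟩
    simp [RAMInstr.exec, RAMConfig.readAddr, rd a (by omega), rd b (by omega), hp,
      RAMConfig.write, hpS, hμ b]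
  case readM d =>
    exact ⟨_, fits_update hμ h.1 d, h.2, by simp [RAMInstr.exec, key d hI _ h.1]⟩
  case readN d =>
    exact ⟨_, fits_update hμ h.1 d, h.2, by simp [RAMInstr.exec, key d hI _ h.1]⟩

theorem Ok.op (hS : 32 ≤ S) {l : List RAMInstr} {μ : ℕ → ℤ} {t : ℕ} {Q : (ℕ → ℤ) → Prop}
    (hl : l.all RAMInstr.Below = true) (ht : l.length ≤ t) (h : wpList m n S W l Q μ) :
    Ok w S W (.op l) μ t Q := by
  intro hμ P o hP
  refine ⟨l.length, ht, ?_⟩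
  clear ht
  simp only [Cmd.code, Cmd.len] at hP ⊢
  induction l generalizing μ o with
  | nil => exact ⟨μ, hμ, h, fun r => by simp⟩
  | cons I l ih =>
    simp only [List.all_cons, Bool.and_eq_true] at hl
    obtain ⟨μ₁, hμ₁, h₁, he⟩ := exec_of_wp (w := w) hS hl.1 hμ h o
    obtain ⟨hP₁, hP₂⟩ := RAMProgram.HasAt.cons hP
    obtain ⟨μ₂, hμ₂, h₂, hr⟩ := ih hl.2 h₁ hμ₁ _ hP₂
    refine ⟨μ₂, hμ₂, h₂, ?_⟩
    have := (RAMProgram.reaches_one (c := ⟨o, μ⟩) hP₁ he).trans hr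
    rwa [add_comm 1, add_assoc, add_comm 1] at this

theorem Ok.op_seq (hS : 32 ≤ S) {l : List RAMInstr} {c : Cmd} {μ : ℕ → ℤ} {t : ℕ}
    {Q : (ℕ → ℤ) → Prop} (hl : l.all RAMInstr.Below = true) (t' : ℕ) (ht : l.length + t' ≤ t)
    (h : wpList m n S W l (fun μ' => Ok w S W c μ' t' Q) μ) :
    Ok w S W (.op l ;; c) μ t Q :=
  Ok.seq _ _ ht (Ok.op hS hl le_rfl h)

section StraightLine

variable {d a b : ℕ} {l : List RAMInstr} {Q : (ℕ → ℤ) → Prop} {μ : ℕ → ℤ} {v : ℤ}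

theorem wpList_const {v : ℤ} (hf : v.bitLength ≤ W)
    (h : wpList m n S W l Q (Function.update μ d v)) : wpList m n S W (.const d v :: l) Q μ :=
  ⟨hf, h⟩

theorem wpList_add (hv : μ a + μ b = v) (hf : v.bitLength ≤ W)
    (h : wpList m n S W l Q (Function.update μ d v)) : wpList m n S W (.add d a b :: l) Q μ := by
  subst hv; exact ⟨hf, h⟩

theorem wpList_sub (hv : μ a - μ b = v) (hf : v.bitLength ≤ W)
    (h : wpList m n S W l Q (Function.update μ d v)) : wpList m n S W (.sub d a b :: l) Q μ := by
  subst hv; exact ⟨hf, h⟩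

theorem wpList_mul (hv : μ a * μ b = v) (hf : v.bitLength ≤ W)
    (h : wpList m n S W l Q (Function.update μ d v)) : wpList m n S W (.mul d a b :: l) Q μ := by
  subst hv; exact ⟨hf, h⟩

theorem wpList_div {x y : ℤ} (hx : μ a = x) (hy : μ b = y) (hy0 : y ≠ 0) (hv : x.fdiv y = v)
    (hf : v.bitLength ≤ W) (h : wpList m n S W l Q (Function.update μ d v)) :
    wpList m n S W (.div d a b :: l) Q μ := by
  subst hx hy hv; exact ⟨hy0, hf, h⟩

theorem wpList_load (p : ℕ) (hp : μ a = p) (hpS : p < S) (hv : μ p = v)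
    (h : wpList m n S W l Q (Function.update μ d v)) : wpList m n S W (.load d a :: l) Q μ := by
  subst hv; exact ⟨p, hp, hpS, h⟩

theorem wpList_store (p : ℕ) (hp : μ a = p) (hpS : p < S) (hv : μ b = v)
    (h : wpList m n S W l Q (Function.update μ p v)) : wpList m n S W (.store a b :: l) Q μ := by
  subst hv; exact ⟨p, hp, hpS, h⟩

end StraightLine

theorem reaches_jumpLE {P : RAMProgram} {o a b l : ℕ} {μ : ℕ → ℤ} (ha : a < S) (hb : b < S)
    (hP : P[o]? = some (.jumpLE a b l)) :
    P.Reaches w S W 1 ⟨o, μ⟩ ⟨if μ a ≤ μ b then l else o + 1, μ⟩ :=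
  RAMProgram.reaches_one (c := ⟨o, μ⟩) hP
    (by simp [RAMInstr.exec, RAMConfig.read, ha, hb, RAMConfig.goto])

theorem reaches_jump {P : RAMProgram} {o l : ℕ} {μ : ℕ → ℤ} (hP : P[o]? = some (.jump l)) :
    P.Reaches w S W 1 ⟨o, μ⟩ ⟨l, μ⟩ :=
  RAMProgram.reaches_one (c := ⟨o, μ⟩) hP (by simp [RAMInstr.exec, RAMConfig.goto])

theorem Ok.ifLE {a b : ℕ} {c₁ c₂ : Cmd} {μ : ℕ → ℤ} {t : ℕ} {Q : (ℕ → ℤ) → Prop}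
    (ha : a < S) (hb : b < S) (t' : ℕ) (ht : t' + 2 ≤ t)
    (h₁ : μ a ≤ μ b → Ok w S W c₁ μ t' Q) (h₂ : μ b < μ a → Ok w S W c₂ μ t' Q) :
    Ok w S W (.ifLE a b c₁ c₂) μ t Q := by
  intro hμ P o hP
  obtain ⟨hj, hP⟩ := RAMProgram.HasAt.cons hP
  obtain ⟨hP₂, hP⟩ := RAMProgram.HasAt.append hP
  rw [Cmd.length_code] at hP
  obtain ⟨hj', hP₁⟩ := RAMProgram.HasAt.cons hP
  have hr := reaches_jumpLE (w := w) (W := W) (μ := μ) ha hb hj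
  by_cases hab : μ a ≤ μ b
  · rw [if_pos hab] at hr
    rw [show o + 1 + c₂.len + 1 = o + (c₂.len + 2) by omega] at hP₁
    obtain ⟨s, hs, μ', hμ', hQ, hr'⟩ := h₁ hab hμ P _ hP₁
    refine ⟨1 + s, by omega, μ', hμ', hQ, ?_⟩
    have := hr.trans hr'
    rwa [show o + (c₂.len + 2) + c₁.len = o + (Cmd.ifLE a b c₁ c₂).len by
      simp only [Cmd.len]; omega] at this
  · rw [if_neg hab] at hr
    obtain ⟨s, hs, μ', hμ', hQ, hr'⟩ := h₂ (not_le.mp hab) hμ P _ hP₂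
    exact ⟨1 + s + 1, by omega, μ', hμ', hQ, (hr.trans hr').trans (reaches_jump hj')⟩

theorem Ok.ifEq {a b : ℕ} {c₁ c₂ : Cmd} {μ : ℕ → ℤ} {t : ℕ} {Q : (ℕ → ℤ) → Prop}
    (ha : a < S) (hb : b < S) (t' : ℕ) (ht : t' + 4 ≤ t)
    (h₁ : μ a = μ b → Ok w S W c₁ μ t' Q) (h₂ : μ a ≠ μ b → Ok w S W c₂ μ t' Q) :
    Ok w S W (.ifEq a b c₁ c₂) μ t Q := by
  refine Ok.ifLE ha hb (t' + 2) (by omega) (fun h => ?_)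
    (fun h => (h₂ h.ne').mono (by omega) fun _ => id)
  exact Ok.ifLE hb ha t' le_rfl (fun h' => h₁ (le_antisymm h h')) (fun h' => h₂ h'.ne)

theorem Ok.while_false {a b : ℕ} {c : Cmd} {μ : ℕ → ℤ} {t : ℕ} {Q : (ℕ → ℤ) → Prop}
    (ha : a < S) (hb : b < S) (ht : 1 ≤ t) (hab : μ b ≤ μ a) (hQ : Q μ) :
    Ok w S W (.whileLT a b c) μ t Q := by
  intro hμ P o hP
  obtain ⟨hj, hP⟩ := RAMProgram.HasAt.cons hP
  have hr := reaches_jumpLE (w := w) (W := W) (μ := μ) hb ha hj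
  rw [if_pos hab] at hr
  exact ⟨1, ht, μ, hμ, hQ, hr⟩

theorem Ok.while_true {a b : ℕ} {c : Cmd} {μ : ℕ → ℤ} {t : ℕ} {Q : (ℕ → ℤ) → Prop}
    (ha : a < S) (hb : b < S) (t₁ t₂ : ℕ) (ht : t₁ + t₂ + 2 ≤ t) (hab : μ a < μ b)
    (h : Ok w S W c μ t₁ fun μ' => Ok w S W (.whileLT a b c) μ' t₂ Q) :
    Ok w S W (.whileLT a b c) μ t Q := by
  intro hμ P o hP
  have hP₀ := hP
  obtain ⟨hj, hP⟩ := RAMProgram.HasAt.cons hP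
  obtain ⟨hP₁, hP⟩ := RAMProgram.HasAt.append hP
  rw [Cmd.length_code] at hP
  obtain ⟨hj', -⟩ := RAMProgram.HasAt.cons hP
  have hr := reaches_jumpLE (w := w) (W := W) (μ := μ) hb ha hj
  rw [if_neg (not_le.mpr hab)] at hr
  obtain ⟨s₁, hs₁, μ₁, hμ₁, h₁, hr₁⟩ := h hμ P _ hP₁
  obtain ⟨s₂, hs₂, μ₂, hμ₂, hQ, hr₂⟩ := h₁ hμ₁ P _ hP₀
  exact ⟨1 + s₁ + 1 + s₂, by omega, μ₂, hμ₂, hQ,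
    ((hr.trans hr₁).trans (reaches_jump hj')).trans hr₂⟩

/-- The rule for a loop with a known number `r` of iterations. -/
theorem Ok.for {a b : ℕ} {c : Cmd} {Q : (ℕ → ℤ) → Prop} (ha : a < S) (hb : b < S)
    (Inv : ℕ → (ℕ → ℤ) → Prop) (r t₁ : ℕ)
    (hstep : ∀ i < r, ∀ μ, Inv i μ → μ a < μ b ∧ Ok w S W c μ t₁ (Inv (i + 1)))
    (hend : ∀ μ, Inv r μ → μ b ≤ μ a ∧ Q μ) {μ : ℕ → ℤ} (h0 : Inv 0 μ) {t : ℕ}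
    (ht : r * (t₁ + 2) + 1 ≤ t) : Ok w S W (.whileLT a b c) μ t Q := by
  suffices H : ∀ s ≤ r, ∀ μ, Inv (r - s) μ →
      Ok w S W (.whileLT a b c) μ (s * (t₁ + 2) + 1) Q from
    (H r le_rfl μ (by simpa using h0)).mono ht fun _ => id
  intro s
  induction s with
  | zero =>
    intro _ μ hμ
    obtain ⟨h1, h2⟩ := hend μ (by simpa using hμ)
    exact Ok.while_false ha hb (by omega) h1 h2
  | succ s ih =>
    intro hs μ hμ
    obtain ⟨h1, h2⟩ := hstep (r - (s + 1)) (by omega) μ hμ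
    refine Ok.while_true ha hb t₁ (s * (t₁ + 2) + 1) (by rw [Nat.succ_mul]; omega) h1
      (h2.mono le_rfl fun μ' hμ' => ih (by omega) μ' ?_)
    rwa [show r - (s + 1) + 1 = r - s by omega] at hμ'

theorem Ok.query {d : GridDir} {i j dst : ℕ} {c₁ c₂ : Cmd} {μ : ℕ → ℤ} {t : ℕ}
    {Q : (ℕ → ℤ) → Prop} (hi : i < S) (hj : j < S) (hd : dst < S) (t' : ℕ) (ht : t' + 2 ≤ t)
    {x : WithBot ℤ} (hx : w.oracle d (μ i) (μ j) = some x)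
    (h₁ : ∀ z : ℤ, x = z → z.bitLength ≤ W ∧ Ok w S W c₁ (Function.update μ dst z) t' Q)
    (h₂ : x = ⊥ → Ok w S W c₂ μ t' Q) :
    Ok w S W (.query d i j dst c₁ c₂) μ t Q := by
  intro hμ P o hP
  obtain ⟨hq, hP⟩ := RAMProgram.HasAt.cons hP
  obtain ⟨hP₁, hP⟩ := RAMProgram.HasAt.append hP
  rw [Cmd.length_code] at hP
  obtain ⟨hj', hP₂⟩ := RAMProgram.HasAt.cons hP
  induction x using WithBot.recBotCoe with
  | bot =>
    have hr := RAMProgram.reaches_one (w := w) (S := S) (W := W) (c := ⟨o, μ⟩)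
      (c' := ⟨o + (c₁.len + 2), μ⟩) hq
      (by simp [RAMInstr.exec, RAMConfig.read, hi, hj, hx, RAMConfig.goto])
    rw [show o + 1 + c₁.len + 1 = o + (c₁.len + 2) by omega] at hP₂
    obtain ⟨s, hs, μ', hμ', hQ, hr'⟩ := h₂ rfl hμ P _ hP₂
    refine ⟨1 + s, by omega, μ', hμ', hQ, ?_⟩
    have := hr.trans hr'
    rwa [show o + (c₁.len + 2) + c₂.len = o + (Cmd.query d i j dst c₁ c₂).len by
      simp only [Cmd.len]; omega] at this
  | coe z =>
    obtain ⟨hz, h₁⟩ := h₁ z rfl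
    have hr := RAMProgram.reaches_one (w := w) (S := S) (W := W) (c := ⟨o, μ⟩)
      (c' := ⟨o + 1, Function.update μ dst z⟩) hq
      (by simp [RAMInstr.exec, RAMConfig.read, hi, hj, hx, RAMConfig.write, hd, hz])
    obtain ⟨s, hs, μ', hμ', hQ, hr'⟩ := h₁ (fits_update hμ hz dst) P _ hP₁
    exact ⟨1 + s + 1, by omega, μ', hμ', hQ, (hr.trans hr').trans (reaches_jump hj')⟩

end Rules

/-! ### Rows of longest path lengths -/

/-- The edge weights on `ℕ × ℕ`, extended beyond the grid: vertical edges outside of the grid have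
weight `0`, all other edges outside of the grid have weight `-∞`. -/
def GridWeight.ext {m n : ℕ} (w : GridWeight m n) (d : GridDir) (i j : ℕ) : WithBot ℤ :=
  if i + d.di ≤ m ∧ j + d.dj ≤ n then (w.oracle d i j).getD ⊥
  else match d with
    | .fst => 0
    | _ => ⊥

theorem GridWeight.oracle_eq_ext {m n : ℕ} (w : GridWeight m n) {d : GridDir} {i j : ℕ}
    (hi : i + d.di ≤ m) (hj : j + d.dj ≤ n) : w.oracle d i j = some (w.ext d i j) := by
  unfold GridWeight.ext
  rw [if_pos ⟨hi, hj⟩, GridWeight.oracle, dif_pos (by simp [hi, hj])]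
  rfl

/-- The previous entry of a row. -/
def prevEntry (z : ℕ → WithBot ℤ) : ℕ → WithBot ℤ
  | 0 => ⊥
  | q + 1 => z q

theorem prevEntry_sup (x y : ℕ → WithBot ℤ) (q : ℕ) :
    prevEntry (x ⊔ y) q = prevEntry x q ⊔ prevEntry y q := by
  cases q <;> simp [prevEntry]

section Rows

variable {m n : ℕ} (w : GridWeight m n)

/-- The lengths of the longest paths that start with the values `x` in row `i` and move along this
row. -/
def closeRow (i : ℕ) (x : ℕ → WithBot ℤ) : ℕ → WithBot ℤ
  | 0 => x 0
  | q + 1 => x (q + 1) ⊔ (closeRow i x q + w.ext .snd i q)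

/-- The lengths of the longest paths that start with the values `x` in row `i` and end with an edge
to row `i + 1`. -/
def stepRow (i : ℕ) (x : ℕ → WithBot ℤ) (q : ℕ) : WithBot ℤ :=
  (closeRow w i x q + w.ext .fst i q) ⊔ (prevEntry (closeRow w i x) q + w.ext .diag i (q - 1))

/-- The lengths of the longest paths that start with the values `x` in row `i` and end when they
enter row `i + t`. -/
def stepRows (i : ℕ) (x : ℕ → WithBot ℤ) : ℕ → ℕ → WithBot ℤ
  | 0 => x
  | t + 1 => stepRow w (i + t) (stepRows i x t)

theorem closeRow_eq (i : ℕ) (x : ℕ → WithBot ℤ) (q : ℕ) :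
    closeRow w i x q = x q ⊔ (prevEntry (closeRow w i x) q + w.ext .snd i (q - 1)) := by
  cases q <;> simp [closeRow, prevEntry]

theorem stepRows_add (i s t : ℕ) (x : ℕ → WithBot ℤ) :
    stepRows w i x (s + t) = stepRows w (i + s) (stepRows w i x s) t := by
  induction t with
  | zero => rfl
  | succ t ih => rw [← add_assoc, stepRows, ih, stepRows, add_assoc]

theorem closeRow_sup (i : ℕ) (x y : ℕ → WithBot ℤ) :
    closeRow w i (x ⊔ y) = closeRow w i x ⊔ closeRow w i y := by
  funext q
  induction q with
  | zero => rfl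
  | succ q ih =>
    simp only [closeRow, ih, Pi.sup_apply, ← max_add_add_right]
    ac_rfl

theorem stepRow_sup (i : ℕ) (x y : ℕ → WithBot ℤ) :
    stepRow w i (x ⊔ y) = stepRow w i x ⊔ stepRow w i y := by
  funext q
  simp only [stepRow, closeRow_sup, prevEntry_sup, Pi.sup_apply, ← max_add_add_right]
  ac_rfl

theorem stepRows_sup (i t : ℕ) (x y : ℕ → WithBot ℤ) :
    stepRows w i (x ⊔ y) t = stepRows w i x t ⊔ stepRows w i y t := by
  induction t with
  | zero => rfl
  | succ t ih => simp only [stepRows, ih, stepRow_sup]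

theorem closeRow_bot_of {i q : ℕ} {x : ℕ → WithBot ℤ} (h : ∀ q' ≤ q, x q' = ⊥) :
    closeRow w i x q = ⊥ := by
  induction q with
  | zero => exact h 0 le_rfl
  | succ q ih =>
    simp [closeRow, h, ih fun q' hq' => h q' (by omega)]

/-- Causality: the entries up to position `q` depend only on the entries up to position `q`. -/
theorem stepRows_congr {i t q : ℕ} {x y : ℕ → WithBot ℤ} (h : ∀ q' ≤ q, x q' = y q') :
    ∀ q' ≤ q, stepRows w i x t q' = stepRows w i y t q' := by
  induction t with
  | zero => exact h
  | succ t ih =>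
    have hc : ∀ q' ≤ q, closeRow w (i + t) (stepRows w i x t) q' =
        closeRow w (i + t) (stepRows w i y t) q' := by
      intro q' hq'
      induction q' with
      | zero => exact ih 0 (by omega)
      | succ q' ih' => simp only [closeRow, ih _ hq', ih' (by omega)]
    intro q' hq'
    cases q' with
    | zero => simp only [stepRows, stepRow, prevEntry, hc _ hq']
    | succ q' => simp only [stepRows, stepRow, prevEntry, hc _ hq', hc q' (by omega)]

theorem stepRows_bot_of {i t q : ℕ} {x : ℕ → WithBot ℤ} (h : ∀ q' ≤ q, x q' = ⊥) :
    ∀ q' ≤ q, stepRows w i x t q' = ⊥ := by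
  induction t with
  | zero => exact h
  | succ t ih =>
    intro q' hq'
    have hc : ∀ q' ≤ q, closeRow w (i + t) (stepRows w i x t) q' = ⊥ := fun q' hq' =>
      closeRow_bot_of w fun q'' h' => ih q'' (by omega)
    cases q' with
    | zero => simp [stepRows, stepRow, prevEntry, hc _ hq']
    | succ q' => simp [stepRows, stepRow, prevEntry, hc _ hq', hc q' (by omega)]

/-! ### Segments of rows -/

/-- The row whose entries at the positions `c, …, c + h - 1` are given by `X`, all others
being `-∞`. -/
def segRow (h c : ℕ) (X : ℕ → WithBot ℤ) (q : ℕ) : WithBot ℤ :=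
  if c ≤ q ∧ q < c + h then X (q - c) else ⊥

/-- Paths may be grouped by the segment in which they start, where paths that end to the left of
position `r * h` start in one of the segments `0, …, r - 1`. -/
theorem stepRows_segments (h i t : ℕ) (x : ℕ → WithBot ℤ) (r q : ℕ) (hq : q < r * h) :
    stepRows w i x t q =
      (Finset.range r).sup fun c => stepRows w i (segRow h (c * h) fun s => x (c * h + s)) t q := by
  have key : ∀ r, stepRows w i (fun q => if q < r * h then x q else ⊥) t q =
      (Finset.range r).sup fun c =>
        stepRows w i (segRow h (c * h) fun s => x (c * h + s)) t q := by
    intro r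
    induction r with
    | zero => simpa using stepRows_bot_of w (fun _ _ => rfl) q le_rfl
    | succ r ih =>
      rw [Finset.range_add_one, Finset.sup_insert, ← ih, sup_comm, ← Pi.sup_apply, ← stepRows_sup]
      congr 2
      funext q
      simp only [Pi.sup_apply, segRow, Nat.succ_mul]
      by_cases h1 : q < r * h
      · simp [h1, show q < r * h + h by omega, show ¬ r * h ≤ q by omega]
      · by_cases h2 : q < r * h + h
        · simp [h1, h2, show r * h ≤ q by omega, show r * h + (q - r * h) = q by omega]
        · simp [h1, h2]
  rw [← key]
  exact stepRows_congr w (fun q' hq' => by rw [if_pos (by omega)]) q le_rfl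

/-! ### Bounds for the entries -/

/-- The absolute value of `x` is at most `B`, unless `x = -∞`. -/
def AbsLE (B : ℤ) (x : WithBot ℤ) : Prop := ∀ v : ℤ, x = v → |v| ≤ B

theorem absLE_bot (B : ℤ) : AbsLE B ⊥ := fun v hv => by simp at hv

theorem AbsLE.sup {B : ℤ} {x y : WithBot ℤ} (hx : AbsLE B x) (hy : AbsLE B y) :
    AbsLE B (x ⊔ y) := by
  rcases max_choice x y with h | h <;> simpa [h]

theorem AbsLE.add {B C : ℤ} {x y : WithBot ℤ} (hx : AbsLE B x) (hy : AbsLE C y) :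
    AbsLE (B + C) (x + y) := by
  intro v hv
  induction x using WithBot.recBotCoe with
  | bot => simp at hv
  | coe a =>
    induction y using WithBot.recBotCoe with
    | bot => simp at hv
    | coe b =>
      rw [← WithBot.coe_add, WithBot.coe_inj] at hv
      subst hv
      exact (abs_add_le a b).trans (add_le_add (hx a rfl) (hy b rfl))

theorem AbsLE.mono {B C : ℤ} {x : WithBot ℤ} (hx : AbsLE B x) (h : B ≤ C) : AbsLE C x :=
  fun v hv => (hx v hv).trans h

variable {w} {M : ℕ} (hM : ∀ d i j, AbsLE M (w.ext d i j))
include hM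

theorem closeRow_absLE {i : ℕ} {x : ℕ → WithBot ℤ}
    (hx : ∀ q : ℕ, AbsLE (M * (i + q)) (x q)) (q : ℕ) : AbsLE (M * (i + q)) (closeRow w i x q) := by
  induction q with
  | zero => exact hx 0
  | succ q ih =>
    exact (hx _).sup ((ih.add (hM _ _ _)).mono (by push_cast; linarith))

theorem stepRows_absLE {i : ℕ} {x : ℕ → WithBot ℤ}
    (hx : ∀ q : ℕ, AbsLE (M * (i + q)) (x q)) (t q : ℕ) :
    AbsLE (M * ((i + t : ℕ) + q)) (stepRows w i x t q) := by
  induction t generalizing q with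
  | zero => exact hx q
  | succ t ih =>
    have hc := closeRow_absLE hM ih
    refine AbsLE.sup (((hc q).add (hM _ _ _)).mono (by push_cast; linarith)) ?_
    cases q with
    | zero => simpa [prevEntry] using absLE_bot _
    | succ q => exact ((hc q).add (hM _ _ _)).mono (by push_cast; linarith)

end Rows

/-! ### Longest paths -/

section Paths

variable {m n : ℕ} (w : GridWeight m n)

/-- The row with the value `0` at position `0` and `-∞` at all other positions. -/
def sourceRow (q : ℕ) : WithBot ℤ := if q = 0 then 0 else ⊥

/-- The length of the longest path from `v_{0,0}` to `v_{i,q}`. -/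
def longest (i q : ℕ) : WithBot ℤ := closeRow w i (stepRows w 0 sourceRow i) q

theorem ext_of_edge {u v : GridVertex m n} (e : GridEdge u v) {d : GridDir}
    (hi : (v.i : ℕ) = u.i + d.di) (hj : (v.j : ℕ) = u.j + d.dj) :
    w.ext d u.i u.j = w u v e := by
  obtain ⟨⟨ui, hui⟩, ⟨uj, huj⟩⟩ := u
  obtain ⟨⟨vi, hvi⟩, ⟨vj, hvj⟩⟩ := v
  simp only at hi hj
  subst hi hj
  have h := w.oracle_eq_ext (d := d) (i := ui) (j := uj) (by omega) (by omega)
  rw [GridWeight.oracle, dif_pos (by simp; omega), Option.some_inj] at h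
  exact h.symm

theorem longest_edge (d : GridDir) (i q : ℕ) :
    longest w i q + w.ext d i q ≤ longest w (i + d.di) (q + d.dj) := by
  have hx : ∀ i q, stepRows w 0 sourceRow i q ≤ longest w i q := fun i q => by
    unfold longest; rw [closeRow_eq]; exact le_sup_left
  cases d with
  | fst => exact le_trans (by simp [stepRows, stepRow, longest]) (hx (i + 1) q)
  | snd => exact le_sup_right
  | diag =>
    refine le_trans ?_ (hx (i + 1) (q + 1))
    simp [stepRows, stepRow, longest, prevEntry]

theorem addWeight_le_longest {v : GridVertex m n} (p : Quiver.Path (⟨0, 0⟩ : GridVertex m n) v) :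
    p.addWeight (fun {a b} (e : a ⟶ b) => w a b (PLift.down e)) ≤ longest w v.i v.j := by
  induction p with
  | nil => simp [longest, closeRow, stepRows, sourceRow]
  | @cons u v p e ih =>
    rw [Quiver.Path.addWeight_cons]
    obtain ⟨d, hi, hj⟩ := e.down
    rw [← ext_of_edge w e.down hi hj, hi, hj]
    exact (add_le_add_left ih _).trans (longest_edge w d _ _)

/-- The value `x` is at most the length of some path from `v_{0,0}` to `v_{i,q}`. -/
def Attained (i q : ℕ) (x : WithBot ℤ) : Prop :=
  ∃ (hi : i < m + 1) (hq : q < n + 1)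
    (p : Quiver.Path (⟨0, 0⟩ : GridVertex m n) ⟨⟨i, hi⟩, ⟨q, hq⟩⟩),
    x ≤ p.addWeight (fun {a b} (e : a ⟶ b) => w a b (PLift.down e))

variable {w}

theorem Attained.sup {i q : ℕ} {x y : WithBot ℤ} (hx : Attained w i q x) (hy : Attained w i q y) :
    Attained w i q (x ⊔ y) := by
  rcases max_choice x y with h | h <;> simpa [h]

theorem Attained.edge {i q : ℕ} {x : WithBot ℤ} (hx : Attained w i q x) (d : GridDir)
    (hi : i + d.di ≤ m) (hq : q + d.dj ≤ n) :
    Attained w (i + d.di) (q + d.dj) (x + w.ext d i q) := by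
  obtain ⟨hi', hq', p, hp⟩ := hx
  refine ⟨by omega, by omega, p.cons ⟨d, rfl, rfl⟩, ?_⟩
  rw [Quiver.Path.addWeight_cons]
  refine add_le_add hp (le_of_eq ?_)
  exact ext_of_edge w (u := ⟨⟨i, hi'⟩, ⟨q, hq'⟩⟩)
    (v := ⟨⟨i + d.di, by omega⟩, ⟨q + d.dj, by omega⟩⟩) ⟨d, rfl, rfl⟩ rfl rfl

variable (w)

theorem attained_bot {i q : ℕ} (hi : i ≤ m) (hq : q ≤ n) : Attained w i q ⊥ := by
  induction q with
  | zero =>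
    induction i with
    | zero => exact ⟨by omega, by omega, Quiver.Path.nil, bot_le⟩
    | succ i ih =>
      simpa [GridDir.di, GridDir.dj] using
        (ih (by omega)).edge .fst (by simpa [GridDir.di]) (by simp [GridDir.dj])
  | succ q ih =>
    simpa [GridDir.di, GridDir.dj] using
      (ih (by omega)).edge .snd (by simpa [GridDir.di]) (by simpa [GridDir.dj])

/-- `Attained` is closed under suprema and edges, and these are the steps in the recursion that
defines `longest`. -/
theorem attained_longest {i q : ℕ} (hi : i ≤ m) (hq : q ≤ n) : Attained w i q (longest w i q) := by
  induction i generalizing q with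
  | zero =>
    induction q with
    | zero =>
      exact ⟨by omega, by omega, Quiver.Path.nil, by simp [longest, closeRow, stepRows, sourceRow]⟩
    | succ q ih =>
      refine Attained.sup ?_ ((ih (by omega)).edge .snd (by simp [GridDir.di]) hq)
      simpa [stepRows, sourceRow] using attained_bot w hi hq
  | succ i ih =>
    have hs : ∀ q ≤ n, Attained w (i + 1) q (stepRows w 0 sourceRow (i + 1) q) := by
      intro q hq
      simp only [stepRows, stepRow, zero_add]
      refine Attained.sup ((ih (by omega) hq).edge .fst hi hq) ?_
      cases q with
      | zero => simpa [prevEntry] using attained_bot w hi hq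
      | succ q => exact (ih (by omega) (by omega : q ≤ n)).edge .diag hi hq
    induction q with
    | zero => exact hs 0 hq
    | succ q ihq => exact (hs _ hq).sup ((ihq (by omega)).edge .snd hi hq)

theorem isGreatest_longest :
    IsGreatest (w.pathLengths ⟨0, 0⟩ ⟨Fin.last m, Fin.last n⟩) (longest w m n) := by
  constructor
  · obtain ⟨_, _, p, hp⟩ := attained_longest w le_rfl le_rfl
    exact ⟨p, le_antisymm (addWeight_le_longest w p) hp⟩
  · rintro x ⟨p, rfl⟩
    exact addWeight_le_longest w p

/-- Below the grid, the last column carries the length of the longest path. -/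
theorem stepRows_last (t : ℕ) : stepRows w 0 sourceRow (m + 1 + t) n = longest w m n := by
  have hfst : ∀ t, w.ext .fst (m + t) n = 0 := fun t => by simp [GridWeight.ext, GridDir.di]
  have hdiag : ∀ t q, w.ext .diag (m + t) q = ⊥ := fun t q => by
    simp [GridWeight.ext, GridDir.di]
  have hsnd : ∀ t q, w.ext .snd (m + 1 + t) q = ⊥ := fun t q => by
    simp [GridWeight.ext, GridDir.di]; omega
  induction t with
  | zero =>
    have h0 := hfst 0
    have h1 := hdiag 0
    rw [add_zero] at h0 h1
    simp [stepRows, stepRow, h0, h1, longest]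
  | succ t ih =>
    rw [← add_assoc, stepRows, stepRow, closeRow_eq, zero_add, hsnd, ih]
    simp [add_assoc m 1 t, hfst, hdiag]

end Paths

/-! ### Words that hold values in `ℤ ∪ {-∞}` -/

/-- The integer that represents an element of `ℤ ∪ {-∞}` in a word: `0` stands for `-∞`, and the
odd number `2 * v + 1` for the integer `v`. -/
def enc : WithBot ℤ → ℤ
  | ⊥ => 0
  | (v : ℤ) => 2 * v + 1

@[simp] theorem enc_bot : enc ⊥ = 0 := rfl

@[simp] theorem enc_coe (v : ℤ) : enc (v : WithBot ℤ) = 2 * v + 1 := rfl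

theorem enc_eq_zero {x : WithBot ℤ} : enc x = 0 ↔ x = ⊥ := by
  induction x using WithBot.recBotCoe with
  | bot => simp
  | coe v => simp; omega

/-- The parameters of the computation, and how large the words have to be: the grid is contained in
`K × K` vertices with `K = k * h`, which are divided into `k` strips and segments of size `h`; there
are `l + 3` level records of `h + 2` words each after the first `32` words; the finite edge weights
are bounded by `M`; and every number of absolute value less than `B` fits into a word. The factor
`2` in `S_lt` leaves room for the sum of an address and a column number. -/
structure Env {m n : ℕ} (w : GridWeight m n) (S W M : ℕ) (B : ℤ) (h k l : ℕ) : Prop where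
  S_ge : 32 + (l + 3) * (h + 2) ≤ S
  S_lt : 2 * (S : ℤ) < B
  fits : ∀ x : ℤ, -B < x → x < B → x.bitLength ≤ W
  ext_le : ∀ d i j, AbsLE M (w.ext d i j)
  val_lt : (M : ℤ) * (4 * (k * h : ℕ) + 2) + 1 < B
  K_lt : 4 * ((k * h : ℕ) : ℤ) + 4 < B
  m_lt : m < k * h
  n_lt : n < k * h
  h_pos : 0 < h

section Machine

variable {m n : ℕ} {w : GridWeight m n} {S W M : ℕ} {B : ℤ} {h k l : ℕ}

theorem Env.le_S (E : Env w S W M B h k l) : 32 ≤ S := le_trans (by omega) E.S_ge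

theorem Env.enc_lt (E : Env w S W M B h k l) {x : WithBot ℤ}
    (hx : AbsLE (2 * M * (k * h : ℕ)) x) : |enc x| + 2 * M < B := by
  have h1 := E.val_lt
  have h2 : (0 : ℤ) ≤ M * (k * h : ℕ) := by positivity
  have h3 : (0 : ℤ) ≤ M := by positivity
  induction x using WithBot.recBotCoe with
  | bot => simp only [enc_bot, abs_zero]; nlinarith
  | coe v =>
    have h4 := abs_le.mp (hx v rfl)
    have h5 : |enc v| ≤ 4 * (M * (k * h : ℕ)) + 1 := by
      rw [enc_coe, abs_le]; constructor <;> nlinarith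
    nlinarith

/-- All words of the memory may be assumed to fit into `W` bits, so that copying a word needs no
bound for its value. -/
theorem Ok.assume {c : Cmd} {μ : ℕ → ℤ} {t : ℕ} {Q : (ℕ → ℤ) → Prop}
    (H : (∀ a, (μ a).bitLength ≤ W) → Ok w S W c μ t Q) : Ok w S W c μ t Q :=
  fun hμ => H hμ hμ

/-- `M[a] := max M[a] M[t]` for words that represent elements of `ℤ ∪ {-∞}`. -/
def maxInto (a t : ℕ) : Cmd :=
  .ifEq a 0 (.op [.add a t 0]) (.ifEq t 0 (.op []) (.ifLE a t (.op [.add a t 0]) (.op [])))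

theorem maxInto_ok (hS : 32 ≤ S) {a t : ℕ} (ha : a < 32) (ht : t < 32) {μ : ℕ → ℤ}
    {x y : WithBot ℤ} {Q : (ℕ → ℤ) → Prop} (h0 : μ 0 = 0) (hx : μ a = enc x) (hy : μ t = enc y)
    (hQ : Q (Function.update μ a (enc (x ⊔ y)))) : Ok w S W (maxInto a t) μ 11 Q := by
  refine Ok.assume fun hμ => ?_
  have copy : x ⊔ y = y → Ok w S W (.op [.add a t 0]) μ 1 Q := fun hxy =>
    Ok.op hS (by simp [RAMInstr.Below, ha, ht]) (by simp) <| by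
      rw [hxy] at hQ
      simpa [wpList, RAMInstr.wp, h0, hy] using ⟨hy ▸ hμ t, hQ⟩
  have keep : x ⊔ y = x → ∀ s, Ok w S W (.op []) μ s Q := fun hxy s =>
    Ok.op hS (by simp) (by simp) <| by
      rw [hxy, ← hx, Function.update_eq_self] at hQ
      exact hQ
  refine Ok.ifEq (by omega) (by omega) 7 le_rfl (fun h => ?_) fun h => ?_
  · rw [hx, h0, enc_eq_zero] at h
    exact (copy (by simp [h])).mono (by omega) fun _ => id
  · refine Ok.ifEq (by omega) (by omega) 3 le_rfl (fun h' => ?_) fun h' => ?_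
    · rw [hy, h0, enc_eq_zero] at h'
      exact keep (by simp [h']) _
    · rw [hx, h0, Ne, enc_eq_zero] at h
      rw [hy, h0, Ne, enc_eq_zero] at h'
      obtain ⟨u, rfl⟩ := WithBot.ne_bot_iff_exists.mp h
      obtain ⟨v, rfl⟩ := WithBot.ne_bot_iff_exists.mp h'
      refine Ok.ifLE (by omega) (by omega) 1 le_rfl (fun h => ?_) fun h => ?_
      · refine copy (max_eq_right ?_)
        rw [hx, hy, enc_coe, enc_coe] at h
        exact WithBot.coe_le_coe.mpr (by omega)
      · refine keep (max_eq_left ?_) _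
        rw [hx, hy, enc_coe, enc_coe] at h
        exact WithBot.coe_le_coe.mpr (by omega)

/-- `M[dst] := M[src] + w`, where `w` is the extended weight of the edge of kind `d` that starts in
row `M[i]` and column `M[j]`. The numbers `d.di` and `d.dj` serve as addresses of words that hold
these numbers. -/
def addEdge (d : GridDir) (src i j dst : ℕ) : Cmd :=
  let out : Cmd := .op [.add dst (match d with | .fst => src | _ => 0) 0]
  .ifEq src 0 (.op [.add dst 0 0])
    (.op [.add 29 i d.di] ;; .ifLE 29 2
      (.op [.add 29 j d.dj] ;; .ifLE 29 3
        (.query d i j dst (.op [.add dst dst dst, .add dst dst src]) (.op [.add dst 0 0])) out)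
      out)

theorem addEdge_ok (E : Env w S W M B h k l) {d : GridDir} {src i j dst : ℕ} (hs : src < 29)
    (hi : i < 29) (hj : j < 29) (hd : dst < 29) (hsd : src ≠ dst) (hd0 : 3 < dst)
    {μ : ℕ → ℤ} {x : WithBot ℤ}
    {i' j' : ℕ} {Q : (ℕ → ℤ) → Prop} (h0 : μ 0 = 0) (h1 : μ 1 = 1) (h2 : μ 2 = m) (h3 : μ 3 = n)
    (hx : μ src = enc x) (hxb : AbsLE (2 * M * (k * h : ℕ)) x) (hi' : μ i = i')
    (hj' : x ≠ ⊥ → μ j = j') (hik : i' ≤ k * h) (hjk : j' ≤ k * h)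
    (hQ : ∀ v, Q (Function.update (Function.update μ 29 v) dst (enc (x + w.ext d i' j')))) :
    Ok w S W (addEdge d src i j dst) μ 14 Q := by
  have hS := E.le_S
  have hK := E.K_lt
  have hQ' : Q (Function.update μ dst (enc (x + w.ext d i' j'))) := by
    have := hQ (μ 29)
    rwa [Function.update_eq_self] at this
  refine Ok.assume fun hμ => ?_
  have hdi : μ d.di = (d.di : ℕ) := by cases d <;> simp [GridDir.di, h0, h1]
  have hdj : μ d.dj = (d.dj : ℕ) := by cases d <;> simp [GridDir.dj, h0, h1]
  have hdi1 : d.di ≤ 1 := by cases d <;> simp [GridDir.di]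
  have hdj1 : d.dj ≤ 1 := by cases d <;> simp [GridDir.dj]
  have out : x ≠ ⊥ → ¬ (i' + d.di ≤ m ∧ j' + d.dj ≤ n) → ∀ v t, 1 ≤ t →
      Ok w S W (.op [.add dst (match d with | .fst => src | _ => 0) 0])
        (Function.update μ 29 v) t Q := by
    intro hxb hij v t ht
    have hQ := hQ v
    refine Ok.op hS ?_ ht ?_
    · cases d <;> simp [RAMInstr.Below] <;> omega
    · have hb : (0 : ℤ).bitLength ≤ W := h0 ▸ hμ 0
      have hb' : (enc x).bitLength ≤ W := hx ▸ hμ src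
      unfold GridWeight.ext at hQ
      rw [if_neg hij] at hQ
      cases d <;> simp only [wpList, RAMInstr.wp] <;>
        simp (disch := omega) only [Function.update_of_ne, h0, hx, add_zero] <;>
        first | exact ⟨hb', by simpa using hQ⟩ | exact ⟨hb, by simpa using hQ⟩
  refine Ok.ifEq (by omega) (by omega) 10 le_rfl (fun hb => ?_) fun hb => ?_
  · rw [hx, h0, enc_eq_zero] at hb
    subst hb
    refine Ok.op hS (by simp [RAMInstr.Below]; omega) (by simp) ?_
    simp only [wpList, RAMInstr.wp, h0, add_zero]
    exact ⟨h0 ▸ hμ 0, by simpa using hQ'⟩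
  · rw [hx, h0, Ne, enc_eq_zero] at hb
    have hj' := hj' hb
    refine Ok.op_seq hS (by simp [RAMInstr.Below]; omega) 9 (by simp) ?_
    simp only [wpList, RAMInstr.wp]
    refine ⟨E.fits _ (by omega) (by omega), ?_⟩
    refine Ok.ifLE (by omega) (by omega) 7 le_rfl (fun hm => ?_) fun hm => ?_
    · simp (disch := omega) only [Function.update_self, Function.update_of_ne, hi', hdi, h2] at hm
      refine Ok.op_seq hS (by simp [RAMInstr.Below]; omega) 6 (by simp) ?_
      simp only [wpList, RAMInstr.wp, Function.update_idem]
      simp (disch := omega) only [Function.update_of_ne]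
      refine ⟨E.fits _ (by omega) (by omega), ?_⟩
      refine Ok.ifLE (by omega) (by omega) 4 le_rfl (fun hn => ?_) fun hn => ?_
      · simp (disch := omega) only [Function.update_self, Function.update_of_ne, hj', hdj, h3] at hn
        refine Ok.query (by omega) (by omega) (by omega) 2 le_rfl (x := w.ext d i' j') ?_
          (fun z hz => ?_) (fun hz => ?_)
        · simp (disch := omega) only [Function.update_of_ne, hi', hj']
          exact w.oracle_eq_ext (by omega) (by omega)
        · have hzM := abs_le.mp (E.ext_le d i' j' z hz)
          have hxE := E.enc_lt hxb
          have hxE' := abs_le.mp (le_refl |enc x|)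
          have hBK : (0 : ℤ) ≤ M * (k * h : ℕ) := by positivity
          have hv := E.val_lt
          have hMB : 2 * (M : ℤ) + 1 < B := by nlinarith
          refine ⟨E.fits _ (by omega) (by omega), ?_⟩
          refine Ok.op hS (by simp [RAMInstr.Below]; omega) (by simp) ?_
          simp only [wpList, RAMInstr.wp, Function.update_idem, Function.update_self]
          simp (disch := omega) only [Function.update_of_ne, hx]
          refine ⟨E.fits _ (by omega) (by omega), E.fits _ (by omega) (by omega), ?_⟩
          have hQ := hQ (μ j + μ d.dj)
          rw [hz] at hQ
          convert hQ using 2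
          obtain ⟨u, rfl⟩ := WithBot.ne_bot_iff_exists.mp hb
          rw [← WithBot.coe_add, enc_coe, enc_coe]
          ring
        · refine Ok.op hS (by simp [RAMInstr.Below]; omega) (by simp) ?_
          simp only [wpList, RAMInstr.wp]
          simp (disch := omega) only [Function.update_of_ne, h0, add_zero]
          refine ⟨h0 ▸ hμ 0, ?_⟩
          have hQ := hQ (μ j + μ d.dj)
          rw [hz] at hQ
          simpa using hQ
      · simp (disch := omega) only [Function.update_self, Function.update_of_ne, hj', hdj, h3] at hn
        exact out hb (by omega) _ _ (by omega)
    · simp (disch := omega) only [Function.update_self, Function.update_of_ne, hi', hdi, h2] at hm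
      exact out hb (by omega) _ _ (by omega)

/-! ### The computation for a single strip

Words `0`, …, `9` of the working memory hold the constants listed in `Consts`. Word `10` holds the
address of the record of the current level (`32`, the address of level `0`, asks for the computation
of a strip), word `11` is `2 ^ j * h` at the current level `j`, and word `12` the first row of the
current strip. The words `13`, …, `31` are used for temporary values. The array of level `0`, at
address `34`, holds the current column.
-/

/-- The address of the record of level `j`, which consists of two words for the current choice at
this level and of an array of `h` words. -/
def levelAddr (h j : ℕ) : ℕ := 32 + j * (h + 2)

/-- The contents of the words that are constant during the main loop. -/
structure Consts (m n h k l : ℕ) (μ : ℕ → ℤ) : Prop where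
  zero : μ 0 = 0
  one : μ 1 = 1
  m_eq : μ 2 = m
  n_eq : μ 3 = n
  h_eq : μ 4 = h
  K_eq : μ 5 = (k * h : ℕ)
  g_eq : μ 6 = (h + 2 : ℕ)
  end_eq : μ 7 = levelAddr h (l + 1)
  first_eq : μ 8 = levelAddr h 1
  column_eq : μ 9 = (34 : ℕ)

theorem Consts.congr {μ μ' : ℕ → ℤ} (hC : Consts m n h k l μ) (H : ∀ a < 10, μ' a = μ a) :
    Consts m n h k l μ' := by
  obtain ⟨h0, h1, h2, h3, h4, h5, h6, h7, h8, h9⟩ := hC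
  constructor <;> rw [H _ (by omega)] <;> assumption

/-- One entry of a column: word `25` holds the entry above, and the word at the address in word `24`
the entry to the left, which is replaced. -/
def rowBody : Cmd :=
  .op [.load 26 24] ;; addEdge .snd 26 23 22 28 ;; maxInto 25 28 ;; .op [.store 24 25] ;;
    addEdge .fst 25 23 21 27 ;; addEdge .diag 26 23 22 28 ;; maxInto 27 28 ;;
    .op [.add 25 27 0, .add 23 23 1, .add 24 24 1]

theorem rowBody_ok (E : Env w S W M B h k l) {μ : ℕ → ℤ} (hC : Consts m n h k l μ)
    {i q p : ℕ} {x o : WithBot ℤ} {Q : (ℕ → ℤ) → Prop}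
    (h21 : μ 21 = q) (h22 : μ 22 = q - 1) (h23 : μ 23 = i) (h24 : μ 24 = p) (hp : 32 ≤ p)
    (hpS : p < S) (h25 : μ 25 = enc x) (hpo : μ p = enc o) (ho : o ≠ ⊥ → 1 ≤ q)
    (hi : i < k * h) (hq : q < k * h)
    (hob : AbsLE (2 * M * (k * h : ℕ)) o)
    (hzb : AbsLE (2 * M * (k * h : ℕ)) (x ⊔ (o + w.ext .snd i (q - 1))))
    (hQ : ∀ μ' : ℕ → ℤ, (∀ a, a < 23 ∨ (32 ≤ a ∧ a ≠ p) → μ' a = μ a) → μ' 23 = (i + 1 : ℕ) →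
      μ' 24 = (p + 1 : ℕ) → μ' p = enc (x ⊔ (o + w.ext .snd i (q - 1))) →
      μ' 25 = enc (((x ⊔ (o + w.ext .snd i (q - 1))) + w.ext .fst i q) ⊔
        (o + w.ext .diag i (q - 1))) → Q μ') :
    Ok w S W rowBody μ 70 Q := by
  have hS := E.le_S
  have hSB := E.S_lt
  have hK := E.K_lt
  obtain ⟨h0, h1, h2, h3, -, -, -, -, -, -⟩ := hC
  have hqm : o ≠ ⊥ → μ 22 = (q - 1 : ℕ) := fun h => by have := ho h; omega
  refine Ok.op_seq hS (by decide) 69 (by simp) ?_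
  refine ⟨p, h24, hpS, ?_⟩
  rw [hpo]
  refine Ok.seq 14 55 (by omega) ?_
  refine addEdge_ok E (by omega) (by omega) (by omega) (by omega)
    (by omega) (by omega) (x := o) (i' := i) (j' := q - 1) ?_ ?_ ?_ ?_ ?_ hob ?_ ?_ (by omega)
    (by omega) fun v₁ => ?_
  any_goals
    (simp (disch := omega) only [Function.update_of_ne, Function.update_self] <;> assumption)
  refine Ok.seq 11 44 (by omega) ?_
  refine maxInto_ok hS (a := 25) (t := 28) (by omega) (by omega) (x := x)
    (y := o + w.ext .snd i (q - 1)) ?_ ?_ ?_ ?_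
  any_goals
    (simp (disch := omega) only [Function.update_of_ne, Function.update_self] <;> assumption)
  generalize hz : x ⊔ (o + w.ext .snd i (q - 1)) = z at hzb hQ ⊢
  refine Ok.op_seq hS (by decide) 43 (by simp) ?_
  refine ⟨p, ?_, hpS, ?_⟩
  · simp (disch := omega) only [Function.update_of_ne, h24]
  refine Ok.seq 14 29 (by omega) ?_
  refine addEdge_ok E (by omega) (by omega) (by omega) (by omega)
    (by omega) (by omega) (x := z) (i' := i) (j' := q) ?_ ?_ ?_ ?_ ?_ hzb ?_ (fun _ => ?_)
    (by omega) (by omega) fun v₂ => ?_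
  any_goals
    (simp (disch := omega) only [Function.update_of_ne, Function.update_self] <;> assumption)
  refine Ok.seq 14 15 (by omega) ?_
  refine addEdge_ok E (by omega) (by omega) (by omega) (by omega)
    (by omega) (by omega) (x := o) (i' := i) (j' := q - 1) ?_ ?_ ?_ ?_ ?_ hob ?_ ?_ (by omega)
    (by omega) fun v₃ => ?_
  any_goals
    (simp (disch := omega) only [Function.update_of_ne, Function.update_self] <;> assumption)
  refine Ok.seq 11 3 (by omega) ?_
  refine maxInto_ok hS (a := 27) (t := 28) (by omega) (by omega)
    (x := z + w.ext .fst i q) (y := o + w.ext .diag i (q - 1)) ?_ ?_ ?_ ?_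
  any_goals
    (simp (disch := omega) only [Function.update_of_ne, Function.update_self] <;> assumption)
  refine Ok.assume fun hμ => ?_
  have hf := hμ 27
  rw [Function.update_self] at hf
  refine Ok.op hS (by decide) (by simp) ?_
  simp only [wpList, RAMInstr.wp]
  simp (disch := omega) only [Function.update_of_ne, Function.update_self, h0, h1, h23, h24,
    add_zero]
  refine ⟨hf, E.fits _ (by omega) (by omega), E.fits _ (by omega) (by omega), ?_⟩
  refine hQ _ (fun a ha => ?_) ?_ ?_ ?_ ?_
  any_goals simp (disch := omega) only [Function.update_of_ne, Function.update_self, Nat.cast_add,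
    Nat.cast_one]

/-- One column of a strip, from the array at `M[15] + q` to the array at `M[16] + q` for the
column `q = M[21]`. -/
def columnBody : Cmd :=
  .ifLE 19 21 (.op [.add 25 0 0]) (.op [.add 28 21 15, .load 25 28]) ;;
    .op [.sub 22 21 1, .add 23 12 0, .add 24 9 0] ;;
    .whileLT 23 17 rowBody ;;
    .ifLE 20 21 (.op [.add 28 21 16, .load 27 28] ;; maxInto 27 25 ;; .op [.store 28 27])
      (.op []) ;;
    .op [.add 21 21 1]

/-- The registers during the computation for the strip of the rows `i, …, i + h`, from the segment
that starts in column `c`, given by the array at address `xa`, to the segment that starts in column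
`d`, given by the array at address `ya`. -/
structure StripRegs (m n h k l i c d xa ya : ℕ) (μ : ℕ → ℤ) : Prop where
  consts : Consts m n h k l μ
  row : μ 12 = i
  source : μ 15 = xa - c
  target : μ 16 = ya - d
  rowEnd : μ 17 = (i + h : ℕ)
  sourceEnd : μ 19 = (c + h : ℕ)
  targetStart : μ 20 = d

theorem StripRegs.congr {i c d xa ya : ℕ} {μ μ' : ℕ → ℤ} (H : StripRegs m n h k l i c d xa ya μ)
    (hμ : ∀ a < 21, μ' a = μ a) : StripRegs m n h k l i c d xa ya μ' := by
  obtain ⟨hC, h1, h2, h3, h4, h5, h6⟩ := H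
  refine ⟨hC.congr fun a ha => hμ a (by omega), ?_, ?_, ?_, ?_, ?_, ?_⟩ <;>
    rw [hμ _ (by omega)] <;> assumption

theorem AbsLE.of_row {i q : ℕ} {x : WithBot ℤ} (hx : AbsLE (M * (i + q)) x) (hi : i ≤ k * h)
    (hq : q ≤ k * h) : AbsLE (2 * M * (k * h : ℕ)) x := by
  refine hx.mono ?_
  have h1 : (i : ℤ) ≤ (k * h : ℕ) := by exact_mod_cast hi
  have h2 : (q : ℤ) ≤ (k * h : ℕ) := by exact_mod_cast hq
  have h3 : (0 : ℤ) ≤ M := by positivity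
  nlinarith

theorem rowLoop_ok (E : Env w S W M B h k l) {i q : ℕ} {x : ℕ → WithBot ℤ} {μ : ℕ → ℤ}
    (hC : Consts m n h k l μ) (h17 : μ 17 = (i + h : ℕ)) (hi : i + h ≤ k * h)
    (hxb : ∀ q : ℕ, AbsLE (M * (i + q)) (x q)) (hq : q < k * h) (h21 : μ 21 = q)
    (h22 : μ 22 = q - 1) (h23 : μ 23 = i) (h24 : μ 24 = (34 : ℕ)) (h25 : μ 25 = enc (x q))
    (hV : ∀ r < h, μ (34 + r) =
      enc (prevEntry (closeRow w (i + r) (stepRows w i x r)) q))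
    {Q : (ℕ → ℤ) → Prop}
    (hQ : ∀ μ' : ℕ → ℤ, (∀ a, a < 23 ∨ 34 + h ≤ a → μ' a = μ a) →
      μ' 25 = enc (stepRows w i x h q) →
      (∀ r < h, μ' (34 + r) = enc (closeRow w (i + r) (stepRows w i x r) q)) → Q μ') :
    Ok w S W (.whileLT 23 17 rowBody) μ (h * 72 + 1) Q := by
  have hS := E.le_S
  have hSh : 34 + h ≤ S := by
    have := E.S_ge
    nlinarith
  refine Ok.for (by omega) (by omega)
    (fun r μ' => (∀ a, a < 23 ∨ 34 + h ≤ a → μ' a = μ a) ∧ μ' 23 = (i + r : ℕ) ∧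
      μ' 24 = (34 + r : ℕ) ∧ μ' 25 = enc (stepRows w i x r q) ∧
      ∀ s < h, μ' (34 + s) =
        enc (if s < r then closeRow w (i + s) (stepRows w i x s) q
          else prevEntry (closeRow w (i + s) (stepRows w i x s)) q))
    h 70 ?_ ?_ ?_ le_rfl
  · rintro r hr μ₁ ⟨hf, g23, g24, g25, gV⟩
    refine ⟨by rw [g23, hf 17 (by omega), h17]; omega, ?_⟩
    have hrows := stepRows_absLE E.ext_le hxb r
    have hclose := closeRow_absLE E.ext_le hrows
    have hz := closeRow_eq w (i + r) (stepRows w i x r) q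
    refine rowBody_ok E (hC.congr fun a ha => hf a (by omega)) (i := i + r) (q := q) (p := 34 + r)
      (x := stepRows w i x r q) (o := prevEntry (closeRow w (i + r) (stepRows w i x r)) q)
      (by rw [hf 21 (by omega), h21]) (by rw [hf 22 (by omega), h22]) g23 g24 (by omega)
      (by omega) g25 (by rw [gV r hr, if_neg (by omega)]) ?_ (by omega) hq ?_ ?_ ?_
    · intro ho
      cases q with
      | zero => exact absurd rfl ho
      | succ q => omega
    · cases q with
      | zero => exact absLE_bot _
      | succ q => exact (hclose q).of_row (by omega) (by omega)
    · rw [← hz]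
      exact (hclose q).of_row (by omega) (by omega)
    · rw [← hz]
      intro μ' f1 f2 f3 f4 f5
      refine ⟨fun a ha => by rw [f1 a (by omega), hf a (by omega)], f2, f3, f5, fun s hs => ?_⟩
      by_cases hsr : s = r
      · subst hsr
        rw [f4, if_pos (by omega)]
      · rw [f1 _ (by omega), gV s hs]
        congr 1
        by_cases h' : s < r
        · rw [if_pos h', if_pos (by omega)]
        · rw [if_neg h', if_neg (by omega)]
  · rintro μ₁ ⟨hf, g23, g24, g25, gV⟩
    refine ⟨by rw [g23, hf 17 (by omega), h17], hQ μ₁ hf g25 fun r hr => ?_⟩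
    rw [gV r hr, if_pos hr]
  · exact ⟨fun _ _ => rfl, by simpa using h23, by simpa using h24, h25, fun s hs => by
      simpa using hV s hs⟩

/-- If before the computation of column `q` the array of level `0` holds the entries to the left of
this column, then afterwards it holds the entries of this column, and the entry of the target row
in this column, if any, has been updated. -/
theorem columnBody_ok (E : Env w S W M B h k l) {i c d xa ya q : ℕ} {X : ℕ → WithBot ℤ}
    {μ : ℕ → ℤ} (H : StripRegs m n h k l i c d xa ya μ) (hi : i + h ≤ k * h)
    (hxb : ∀ q : ℕ, AbsLE (M * (i + q)) (segRow h c X q)) (hcq : c ≤ q) (hqd : q < d + h)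
    (hq : q < k * h) (h21 : μ 21 = q)
    (hxa : 34 + h ≤ xa) (hxS : xa + h ≤ S) (hya : 34 + h ≤ ya) (hyS : ya + h ≤ S)
    (hX : ∀ s < h, μ (xa + s) = enc (X s))
    (hV : ∀ r < h, μ (34 + r) =
      enc (prevEntry (closeRow w (i + r) (stepRows w i (segRow h c X) r)) q))
    {y : WithBot ℤ} (hy : d ≤ q → μ (ya + (q - d)) = enc y) {Q : (ℕ → ℤ) → Prop}
    (hQ : ∀ μ' : ℕ → ℤ,
      (∀ a, a < 21 ∨ (34 + h ≤ a ∧ ¬ (d ≤ q ∧ a = ya + (q - d))) → μ' a = μ a) →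
      μ' 21 = (q + 1 : ℕ) →
      (∀ r < h, μ' (34 + r) = enc (closeRow w (i + r) (stepRows w i (segRow h c X) r) q)) →
      (d ≤ q → μ' (ya + (q - d)) = enc (y ⊔ stepRows w i (segRow h c X) h q)) → Q μ') :
    Ok w S W columnBody μ (h * 72 + 25) Q := by
  have hS := E.le_S
  have hSB := E.S_lt
  have hK := E.K_lt
  obtain ⟨hC, g12, g15, g16, g17, g19, g20⟩ := H
  obtain ⟨h0, h1, -, -, -, -, -, -, -, h9⟩ := id hC
  -- the common continuation after the entry at the top of the column has been read
  have main : ∀ μ₁ : ℕ → ℤ, (∀ a, a < 25 ∨ 32 ≤ a → μ₁ a = μ a) →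
      μ₁ 25 = enc (segRow h c X q) →
      Ok w S W (.op [.sub 22 21 1, .add 23 12 0, .add 24 9 0] ;;
        .whileLT 23 17 rowBody ;;
        .ifLE 20 21 (.op [.add 28 21 16, .load 27 28] ;; maxInto 27 25 ;; .op [.store 28 27])
          (.op []) ;; .op [.add 21 21 1]) μ₁ (h * 72 + 21) Q := by
    intro μ₁ f g25
    refine Ok.op_seq hS (by decide) (h * 72 + 18) (by simp; omega) ?_
    simp only [wpList, RAMInstr.wp]
    simp (disch := omega) only [Function.update_of_ne, f, h0, h1, h21, g12, h9, add_zero]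
    refine ⟨E.fits _ (by omega) (by omega), E.fits _ (by omega) (by omega),
      E.fits _ (by omega) (by omega), ?_⟩
    refine Ok.seq (h * 72 + 1) 17 (by omega) ?_
    refine rowLoop_ok E (i := i) (q := q) (x := segRow h c X) (hC.congr fun a ha => ?_) ?_ hi hxb hq
      ?_ ?_ ?_ ?_ ?_ (fun r hr => ?_) fun μ₂ f₂ k25 kV => ?_
    any_goals simp (disch := omega) only [Function.update_of_ne, Function.update_self, f]
    any_goals assumption
    · exact hV r hr
    have f₂' : ∀ a, a < 22 ∨ 34 + h ≤ a → μ₂ a = μ a := fun a ha => by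
      rw [f₂ a (by omega)]
      simp (disch := omega) only [Function.update_of_ne, f]
    clear f₂
    have last : ∀ μ₃ : ℕ → ℤ,
        (∀ a, a < 22 ∨ (34 + h ≤ a ∧ ¬ (d ≤ q ∧ a = ya + (q - d))) → μ₃ a = μ a) →
        (∀ r < h, μ₃ (34 + r) = enc (closeRow w (i + r) (stepRows w i (segRow h c X) r) q)) →
        (d ≤ q → μ₃ (ya + (q - d)) = enc (y ⊔ stepRows w i (segRow h c X) h q)) →
        Ok w S W (.op [.add 21 21 1]) μ₃ 1 Q := by
      intro μ₃ e1 e2 e3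
      refine Ok.op hS (by decide) (by simp) ?_
      simp only [wpList, RAMInstr.wp]
      rw [e1 21 (by omega), e1 1 (by omega), h21, h1]
      refine ⟨E.fits _ (by omega) (by omega), hQ _ (fun a ha => ?_) ?_ (fun r hr => ?_)
        fun hdq => ?_⟩
      · rw [Function.update_of_ne (by omega), e1 a (by omega)]
      · simp
      · rw [Function.update_of_ne (by omega), e2 r hr]
      · rw [Function.update_of_ne (by omega), e3 hdq]
    refine Ok.seq 16 1 (by omega) ?_
    refine Ok.ifLE (by omega) (by omega) 14 le_rfl (fun hdq => ?_) fun hdq => ?_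
    · rw [f₂' 20 (by omega), f₂' 21 (by omega), g20, h21] at hdq
      have hdq : d ≤ q := by omega
      refine Ok.op_seq hS (by decide) 12 (by simp) ?_
      simp only [wpList, RAMInstr.wp]
      simp (disch := omega) only [Function.update_self, f₂', h21, g16]
      refine ⟨E.fits _ (by omega) (by omega), ya + (q - d), by omega, by omega, ?_⟩
      simp (disch := omega) only [Function.update_of_ne, f₂', hy hdq]
      refine Ok.seq 11 1 (by omega) ?_
      refine maxInto_ok hS (by omega) (by omega) (x := y)
        (y := stepRows w i (segRow h c X) h q) ?_ ?_ ?_ ?_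
      any_goals simp (disch := omega) only [Function.update_of_ne, Function.update_self, f₂',
        h0, k25]
      refine Ok.op hS (by decide) (by simp) ?_
      refine ⟨ya + (q - d), ?_, by omega, ?_⟩
      · simp (disch := omega) only [Function.update_of_ne, Function.update_self]
        omega
      simp only [wpList]
      refine last _ (fun a ha => ?_) (fun r hr => ?_) fun _ => ?_
      · simp (disch := omega) only [Function.update_of_ne, f₂']
      · simp (disch := omega) only [Function.update_of_ne, kV]
      · simp (disch := omega) only [Function.update_self]
    · rw [f₂' 20 (by omega), f₂' 21 (by omega), g20, h21] at hdq
      refine Ok.op hS (by decide) (by simp) ?_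
      exact last _ (fun a ha => f₂' a (by omega)) kV fun h' => by omega
  refine Ok.seq 4 (h * 72 + 21) (by omega) ?_
  refine Ok.ifLE (by omega) (by omega) 2 le_rfl (fun hx => ?_) fun hx => ?_
  · rw [g19, h21] at hx
    refine Ok.op hS (by decide) (by simp) ?_
    simp only [wpList, RAMInstr.wp, h0, add_zero]
    refine ⟨E.fits _ (by omega) (by omega), main _ (fun a ha => ?_) ?_⟩
    · rw [Function.update_of_ne (by omega)]
    · rw [Function.update_self, segRow, if_neg (by omega), enc_bot]
  · rw [g19, h21] at hx
    refine Ok.op hS (by decide) (by simp) ?_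
    simp only [wpList, RAMInstr.wp]
    simp (disch := omega) only [Function.update_self, h21, g15]
    refine ⟨E.fits _ (by omega) (by omega), xa + (q - c), by omega, by omega, ?_⟩
    simp (disch := omega) only [Function.update_of_ne, hX]
    refine main _ (fun a ha => ?_) ?_
    · simp (disch := omega) only [Function.update_of_ne]
    · rw [Function.update_self, segRow, if_pos (by omega)]

theorem levelAddr_succ (j : ℕ) : levelAddr h (j + 1) = levelAddr h j + (h + 2) := by
  simp only [levelAddr, Nat.succ_mul]; omega

theorem levelAddr_lt {i j : ℕ} (hij : i < j) : levelAddr h i + (h + 2) ≤ levelAddr h j := by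
  rw [← levelAddr_succ]
  exact Nat.add_le_add_left (Nat.mul_le_mul_right _ hij) _

theorem levelAddr_ge {j : ℕ} (hj : 1 ≤ j) : 34 + h ≤ levelAddr h j := by
  have := levelAddr_lt (h := h) hj
  simp only [levelAddr] at this ⊢
  omega

theorem Env.levelAddr_le (E : Env w S W M B h k l) {j : ℕ} (hj : j ≤ l + 2) :
    levelAddr h j + (h + 2) ≤ S := by
  refine (levelAddr_lt (Nat.lt_succ_of_le hj)).trans ?_
  exact E.S_ge

/-- `M[r]` becomes the address of the record of the lowest level `j ≥ 1` whose first word violates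
the guard `M[a] < M[b]`, where this word is read as `M[28]`. -/
def findLevel (r a b : ℕ) : Cmd :=
  .op [.add r 8 0, .load 28 r] ;; .whileLT a b (.op [.add r r 6, .load 28 r])

theorem findLevel_ok (E : Env w S W M B h k l) {μ : ℕ → ℤ} (hC : Consts m n h k l μ)
    {r a b : ℕ} (hr : 10 ≤ r) (hr' : r < 28) (ha : a < 32) (hb : b < 32) {f g : ℤ}
    (hf : ∀ μ' : ℕ → ℤ, μ' 0 = 0 → μ' 1 = 1 → μ' 28 = f → μ' a < μ' b)
    (hg : ∀ μ' : ℕ → ℤ, μ' 0 = 0 → μ' 1 = 1 → μ' 28 = g → μ' b ≤ μ' a)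
    {J : ℕ} (hJ : 1 ≤ J) (hJl : J ≤ l + 2) (hJg : μ (levelAddr h J) = g)
    (hJf : ∀ j, 1 ≤ j → j < J → μ (levelAddr h j) = f) {Q : (ℕ → ℤ) → Prop}
    (hQ : ∀ μ' : ℕ → ℤ, (∀ a, a ≠ r → a ≠ 28 → μ' a = μ a) → μ' r = levelAddr h J → Q μ') :
    Ok w S W (findLevel r a b) μ (4 * (l + 2)) Q := by
  have hS := E.le_S
  have hSB := E.S_lt
  have addr : ∀ j ≤ l + 2, 32 ≤ levelAddr h j ∧ levelAddr h j < S := fun j hj =>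
    ⟨by simp [levelAddr], by have := E.levelAddr_le hj; omega⟩
  have h1 := addr 1 (by omega)
  refine Ok.op_seq hS (by simp [RAMInstr.Below]; omega) (4 * l + 6) (by simp; omega) ?_
  simp only [wpList, RAMInstr.wp, hC.zero, hC.first_eq, add_zero]
  refine ⟨E.fits _ (by omega) (by omega), levelAddr h 1, Function.update_self .., h1.2, ?_⟩
  refine Ok.for (by omega) (by omega)
    (fun i μ' => (∀ a, a ≠ r → a ≠ 28 → μ' a = μ a) ∧ μ' r = levelAddr h (i + 1) ∧
      μ' 28 = μ (levelAddr h (i + 1))) (J - 1) 2 ?_ ?_ ?_ ?_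
  · rintro i hi μ' ⟨e1, e2, e3⟩
    have hz : μ' 0 = 0 := by rw [e1 0 (by omega) (by omega), hC.zero]
    have ho : μ' 1 = 1 := by rw [e1 1 (by omega) (by omega), hC.one]
    have hg6 : μ' 6 = (h + 2 : ℕ) := by rw [e1 6 (by omega) (by omega), hC.g_eq]
    refine ⟨hf μ' hz ho (by rw [e3, hJf _ (by omega) (by omega)]), ?_⟩
    have h2 := addr (i + 1 + 1) (by omega)
    have h3 := levelAddr_succ (h := h) (i + 1)
    refine Ok.op hS (by simp [RAMInstr.Below]; omega) (by simp) ?_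
    simp only [wpList, RAMInstr.wp, e2, hg6]
    refine ⟨E.fits _ (by omega) (by omega), levelAddr h (i + 1 + 1), ?_, h2.2,
      fun a ha ha' => ?_, ?_, ?_⟩
    · rw [Function.update_self, h3]; push_cast; ring
    · rw [Function.update_of_ne ha', Function.update_of_ne ha, e1 a ha ha']
    · rw [Function.update_of_ne (by omega), Function.update_self, h3]; push_cast; ring
    · rw [Function.update_self, Function.update_of_ne (by omega), e1 _ (by omega) (by omega)]
  · rintro μ' ⟨e1, e2, e3⟩
    rw [Nat.sub_add_cancel hJ] at e2 e3
    have hz : μ' 0 = 0 := by rw [e1 0 (by omega) (by omega), hC.zero]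
    have ho : μ' 1 = 1 := by rw [e1 1 (by omega) (by omega), hC.one]
    exact ⟨hg μ' hz ho (by rw [e3, hJg]), hQ μ' e1 e2⟩
  · refine ⟨fun a ha ha' => ?_, ?_, ?_⟩
    · rw [Function.update_of_ne ha', Function.update_of_ne ha]
    · rw [Function.update_of_ne (by omega), Function.update_self]
    · rw [Function.update_self, Function.update_of_ne (by omega)]
  · omega

/-- The words with the addresses `M[24], …, M[25] - 1` become `0`. -/
def clearLoop : Cmd := .whileLT 24 25 (.op [.store 24 0, .add 24 24 1])

theorem clearLoop_ok (E : Env w S W M B h k l) {μ : ℕ → ℤ} {p : ℕ} (hp : 32 ≤ p) (hpS : p + h ≤ S)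
    (h0 : μ 0 = 0) (h1 : μ 1 = 1) (h24 : μ 24 = p) (h25 : μ 25 = (p + h : ℕ))
    {Q : (ℕ → ℤ) → Prop}
    (hQ : ∀ μ' : ℕ → ℤ, (∀ a, a ≠ 24 → (a < p ∨ p + h ≤ a) → μ' a = μ a) →
      (∀ s < h, μ' (p + s) = 0) → Q μ') :
    Ok w S W clearLoop μ (4 * h + 1) Q := by
  have hS := E.le_S
  have hSB := E.S_lt
  refine Ok.for (by omega) (by omega)
    (fun i μ' => (∀ a, a ≠ 24 → (a < p ∨ p + h ≤ a) → μ' a = μ a) ∧ μ' 24 = (p + i : ℕ) ∧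
      ∀ s < i, μ' (p + s) = 0) h 2 ?_ ?_ ?_ (by omega)
  · rintro i hi μ' ⟨e1, e2, e3⟩
    refine ⟨by rw [e2, e1 25 (by omega) (by omega), h25]; omega, ?_⟩
    refine Ok.op hS (by decide) (by simp) ?_
    refine ⟨p + i, e2, by omega, ?_⟩
    simp only [wpList, RAMInstr.wp]
    simp (disch := omega) only [Function.update_of_ne, e1, e2, h0, h1]
    refine ⟨E.fits _ (by omega) (by omega), fun a ha ha' => ?_, ?_, fun s hs => ?_⟩
    · rw [Function.update_of_ne ha, Function.update_of_ne (by omega), e1 a ha ha']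
    · simp; ring
    · by_cases hsi : s = i
      · rw [hsi, Function.update_self]
      · rw [Function.update_of_ne (by omega), e3 s (by omega)]
  · rintro μ' ⟨e1, e2, e3⟩
    exact ⟨by rw [e2, e1 25 (by omega) (by omega), h25], hQ μ' e1 e3⟩
  · exact ⟨fun _ _ _ => rfl, by simpa using h24, fun s hs => by omega⟩

/-- The initialization of the registers for `columnBody`, where the words `13` and `14` hold the
addresses of the records of the two levels. -/
def leafSetup : Cmd :=
  .op [.const 29 2, .add 15 13 1, .load 15 15, .add 19 15 4, .add 21 15 0, .add 28 13 29,
    .sub 15 28 15, .add 16 14 1, .load 20 16, .add 18 20 4, .add 28 14 29, .sub 16 28 20,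
    .add 17 12 4, .add 24 9 0, .add 25 9 4]

theorem leafSetup_ok (E : Env w S W M B h k l) {μ : ℕ → ℤ} (hC : Consts m n h k l μ)
    {i c d ai ao : ℕ} (h12 : μ 12 = i) (hi : i + h ≤ k * h) (e13 : μ 13 = ai) (e14 : μ 14 = ao)
    (hai : 32 ≤ ai) (haiS : ai + (h + 2) ≤ S) (hao : 32 ≤ ao) (haoS : ao + (h + 2) ≤ S)
    (hc : μ (ai + 1) = c) (hcK : c + h ≤ k * h) (hd : μ (ao + 1) = d) (hdK : d + h ≤ k * h)
    {Q : (ℕ → ℤ) → Prop}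
    (hQ : ∀ μ' : ℕ → ℤ, (∀ a, a < 15 ∨ 32 ≤ a → μ' a = μ a) →
      StripRegs m n h k l i c d (ai + 2) (ao + 2) μ' → μ' 18 = (d + h : ℕ) → μ' 21 = c →
      μ' 24 = (34 : ℕ) → μ' 25 = (34 + h : ℕ) → Q μ') :
    Ok w S W leafSetup μ 15 Q := by
  have hS := E.le_S
  have hSB := E.S_lt
  have hKB := E.K_lt
  obtain ⟨h0, h1, -, -, h4, -, -, -, -, h9⟩ := id hC
  refine Ok.op hS (by decide) (by simp) ?_
  refine wpList_const (E.fits _ (by omega) (by omega)) ?_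
  refine wpList_add (v := ai + 1) ?_ (E.fits _ (by omega) (by omega)) ?_
  · simp (disch := omega) only [Function.update_of_ne, h1, e13]
    try omega
  refine wpList_load (ai + 1) ?_ (by omega) (v := c) ?_ ?_
  · simp (disch := omega) only [Function.update_self]
    try omega
  · simp (disch := omega) only [Function.update_of_ne, hc]
  refine wpList_add (v := c + h) ?_ (E.fits _ (by omega) (by omega)) ?_
  · simp (disch := omega) only [Function.update_of_ne, Function.update_self, h4]
    try omega
  refine wpList_add (v := c) ?_ (E.fits _ (by omega) (by omega)) ?_
  · simp (disch := omega) only [Function.update_of_ne, Function.update_self, h0]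
    try omega
  refine wpList_add (v := ai + 2) ?_ (E.fits _ (by omega) (by omega)) ?_
  · simp (disch := omega) only [Function.update_of_ne, Function.update_self, e13]
    try omega
  refine wpList_sub (v := ai + 2 - c) ?_ (E.fits _ (by omega) (by omega)) ?_
  · simp (disch := omega) only [Function.update_of_ne, Function.update_self]
    try omega
  refine wpList_add (v := ao + 1) ?_ (E.fits _ (by omega) (by omega)) ?_
  · simp (disch := omega) only [Function.update_of_ne, h1, e14]
    try omega
  refine wpList_load (ao + 1) ?_ (by omega) (v := d) ?_ ?_
  · simp (disch := omega) only [Function.update_self]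
    try omega
  · simp (disch := omega) only [Function.update_of_ne, hd]
  refine wpList_add (v := d + h) ?_ (E.fits _ (by omega) (by omega)) ?_
  · simp (disch := omega) only [Function.update_of_ne, Function.update_self, h4]
    try omega
  refine wpList_add (v := ao + 2) ?_ (E.fits _ (by omega) (by omega)) ?_
  · simp (disch := omega) only [Function.update_of_ne, Function.update_self, e14]
    try omega
  refine wpList_sub (v := ao + 2 - d) ?_ (E.fits _ (by omega) (by omega)) ?_
  · simp (disch := omega) only [Function.update_of_ne, Function.update_self]
    try omega
  refine wpList_add (v := i + h) ?_ (E.fits _ (by omega) (by omega)) ?_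
  · simp (disch := omega) only [Function.update_of_ne, h12, h4]
    try omega
  refine wpList_add (v := 34) ?_ (E.fits _ (by omega) (by omega)) ?_
  · simp (disch := omega) only [Function.update_of_ne, h9, h0]
    try omega
  refine wpList_add (v := 34 + h) ?_ (E.fits _ (by omega) (by omega)) ?_
  · simp (disch := omega) only [Function.update_of_ne, h9, h4]
    try omega
  refine hQ _ (fun a ha => ?_) ⟨hC.congr fun a ha => ?_, ?_, ?_, ?_, ?_, ?_, ?_⟩ ?_ ?_ ?_ ?_
  all_goals
    simp (disch := omega) only [Function.update_of_ne, Function.update_self, h12, Nat.cast_add,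
      Nat.cast_ofNat]

/-- The computation for one strip: it updates the array of the lowest level with first word `0` by
the paths that start with the values in the array of the lowest level with first word `1`. -/
def leaf : Cmd :=
  findLevel 13 28 1 ;; findLevel 14 0 28 ;; leafSetup ;; clearLoop ;;
    .whileLT 21 18 columnBody ;; .op [.add 12 17 0, .add 10 8 0, .add 11 4 4]

/-- A bound for the number of steps of `leaf`. -/
def leafTime (h k l : ℕ) : ℕ := 8 * (l + 2) + 4 * h + k * h * (72 * h + 27) + 20

theorem leaf_ok (E : Env w S W M B h k l) {μ : ℕ → ℤ} (hC : Consts m n h k l μ)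
    {i c d jin jout : ℕ} {X Y : ℕ → WithBot ℤ} (h12 : μ 12 = i) (hi : i + h ≤ k * h)
    (hin : 1 ≤ jin) (hinl : jin ≤ l + 2) (hin1 : μ (levelAddr h jin) = 1)
    (hin0 : ∀ j, 1 ≤ j → j < jin → μ (levelAddr h j) = 0)
    (hout : 1 ≤ jout) (houtl : jout ≤ l + 2) (hout0 : μ (levelAddr h jout) = 0)
    (hout1 : ∀ j, 1 ≤ j → j < jout → μ (levelAddr h j) = 1)
    (hc : μ (levelAddr h jin + 1) = c) (hcK : c + h ≤ k * h)
    (hd : μ (levelAddr h jout + 1) = d) (hdK : d + h ≤ k * h)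
    (hX : ∀ s < h, μ (levelAddr h jin + 2 + s) = enc (X s))
    (hY : ∀ s < h, μ (levelAddr h jout + 2 + s) = enc (Y s))
    (hxb : ∀ q : ℕ, AbsLE (M * (i + q)) (segRow h c X q)) {Q : (ℕ → ℤ) → Prop}
    (hQ : ∀ μ' : ℕ → ℤ,
      (∀ a, a < 10 ∨ (34 + h ≤ a ∧ ¬ (levelAddr h jout + 2 ≤ a ∧ a < levelAddr h (jout + 1))) →
        μ' a = μ a) →
      μ' 10 = levelAddr h 1 → μ' 11 = (2 * h : ℕ) → μ' 12 = (i + h : ℕ) →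
      (∀ s < h, μ' (levelAddr h jout + 2 + s) =
        enc (Y s ⊔ stepRows w i (segRow h c X) h (d + s))) → Q μ') :
    Ok w S W leaf μ (leafTime h k l) Q := by
  have hS := E.le_S
  have hSB := E.S_lt
  have hKB := E.K_lt
  have hne : jin ≠ jout := fun h => by
    rw [h, hout0] at hin1; omega
  have i1 := levelAddr_ge (h := h) hin
  have i2 := levelAddr_ge (h := h) hout
  have i3 := E.levelAddr_le hinl
  have i4 := E.levelAddr_le houtl
  have i5 := E.levelAddr_le (j := 1) (by omega)
  rw [levelAddr_succ] at hQ
  have i6 : levelAddr h jin + (h + 2) ≤ levelAddr h jout ∨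
      levelAddr h jout + (h + 2) ≤ levelAddr h jin := by
    rcases lt_or_gt_of_ne hne with h' | h'
    · exact .inl (levelAddr_lt h')
    · exact .inr (levelAddr_lt h')
  generalize hai : levelAddr h jin = ai at *
  generalize hao : levelAddr h jout = ao at *
  refine Ok.seq (4 * (l + 2)) (4 * (l + 2) + 4 * h + k * h * (72 * h + 27) + 20)
    (by simp only [leafTime]; omega) ?_
  refine findLevel_ok E hC (by omega) (by omega) (by omega) (by omega) (f := 0) (g := 1)
    (fun μ' _ h1 h2 => by omega) (fun μ' _ h1 h2 => by omega) hin hinl (by rw [hai, hin1]) hin0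
    fun μ₁ f1 e13 => ?_
  rw [hai] at e13
  have hC₁ : Consts m n h k l μ₁ := hC.congr fun a ha => f1 a (by omega) (by omega)
  have addr : ∀ j, 32 ≤ levelAddr h j := fun j => by simp [levelAddr]
  refine Ok.seq (4 * (l + 2)) (4 * h + k * h * (72 * h + 27) + 20) (by omega) ?_
  refine findLevel_ok E hC₁ (by omega) (by omega) (by omega) (by omega) (f := 1) (g := 0)
    (fun μ' h0 h1 h2 => by omega) (fun μ' h0 h1 h2 => by omega) hout houtl
    (by rw [hao, f1 _ (by omega) (by omega), hout0])
    (fun j hj hj' => by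
      rw [f1 _ (by have := addr j; omega) (by have := addr j; omega), hout1 j hj hj'])
    fun μ₂ f2 e14 => ?_
  rw [hao] at e14
  have f : ∀ a, a < 13 ∨ 32 ≤ a → μ₂ a = μ a := fun a ha => by
    rw [f2 a (by omega) (by omega), f1 a (by omega) (by omega)]
  have e13 : μ₂ 13 = ai := by rw [f2 13 (by omega) (by omega), e13]
  clear f1 f2 hC₁
  refine Ok.seq 15 (4 * h + k * h * (72 * h + 27) + 5) (by omega) ?_
  refine leafSetup_ok E (hC.congr fun a ha => f a (by omega)) (by rw [f _ (by omega), h12]) hi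
    e13 e14 (by omega) (by omega) (by omega) (by omega) (by rw [f _ (by omega), hc]) hcK
    (by rw [f _ (by omega), hd]) hdK fun μ₂' f2 hreg g18 g21 g24 g25 => ?_
  refine Ok.seq (4 * h + 1) (k * h * (72 * h + 27) + 4) (by omega) ?_
  refine clearLoop_ok E (p := 34) (by omega) (by omega) hreg.consts.zero hreg.consts.one g24 g25
    fun μ₃ f3 k3 => ?_
  have f' : ∀ a, a < 13 ∨ 34 + h ≤ a → μ₃ a = μ a := fun a ha => by
    rw [f3 a (by omega) (by omega), f2 a (by omega), f a (by omega)]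
  replace hreg := hreg.congr (μ' := μ₃) fun a ha => f3 a (by omega) (by omega)
  rw [← f3 _ (by omega) (by omega)] at g18 g21
  obtain ⟨h0, -, -, -, h4, -, -, -, h8, -⟩ := id hC
  clear f f2 f3
  refine Ok.seq (k * h * (72 * h + 27) + 1) 3 (by omega) ?_
  refine Ok.for (by omega) (by omega)
    (fun t μ' =>
      (∀ a, a < 21 ∨ (34 + h ≤ a ∧ ¬ (ao + 2 ≤ a ∧ a < ao + 2 + h)) → μ' a = μ₃ a) ∧
      μ' 21 = (c + t : ℕ) ∧
      (∀ r < h, μ' (34 + r) =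
        enc (prevEntry (closeRow w (i + r) (stepRows w i (segRow h c X) r)) (c + t))) ∧
      ∀ s < h, μ' (ao + 2 + s) = enc (if d + s < c + t then
        Y s ⊔ stepRows w i (segRow h c X) h (d + s) else Y s))
    (d + h - c) (h * 72 + 25) ?_ ?_ ?_ ?_
  · rintro t ht μ₄ ⟨e1, e2, e3, e4⟩
    refine ⟨by rw [e2, e1 18 (by omega), g18]; omega, ?_⟩
    refine columnBody_ok E (hreg.congr fun a ha => e1 a (by omega)) hi hxb (q := c + t)
      (y := Y (c + t - d))
      (by omega) (by omega) (by omega) e2 (by omega) (by omega) (by omega) (by omega)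
      (fun s hs => by rw [e1 _ (by omega), f' _ (by omega), hX s hs]) e3
      (fun hdt => by rw [e4 _ (by omega), if_neg (by omega)]) fun μ₅ u1 u2 u3 u4 => ?_
    refine ⟨fun a ha => by rw [u1 a (by omega), e1 a ha], u2, u3, fun s hs => ?_⟩
    by_cases hst : d + s = c + t
    · have hs' : s = c + t - d := by omega
      rw [if_pos (by omega), hs', u4 (by omega), show d + (c + t - d) = c + t by omega]
    · rw [u1 _ (by omega), e4 s hs]
      congr 1
      by_cases h' : d + s < c + t
      · rw [if_pos h', if_pos (by omega)]
      · rw [if_neg h', if_neg (by omega)]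
  · rintro μ₄ ⟨e1, e2, e3, e4⟩
    refine ⟨by rw [e2, e1 18 (by omega), g18]; omega, ?_⟩
    refine Ok.op hS (by decide) (by simp) ?_
    have g17 : μ₄ 17 = (i + h : ℕ) := by rw [e1 _ (by omega), hreg.rowEnd]
    have e : ∀ a < 10, μ₄ a = μ a := fun a ha => by rw [e1 _ (by omega), f' _ (by omega)]
    simp only [wpList, RAMInstr.wp]
    simp (disch := omega) only [Function.update_of_ne, g17, e, h0, h8, h4, add_zero]
    refine ⟨E.fits _ (by omega) (by omega), E.fits _ (by omega) (by omega),
      E.fits _ (by omega) (by omega), hQ _ (fun a ha => ?_) ?_ ?_ ?_ fun s hs => ?_⟩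
    · rw [Function.update_of_ne (by omega), Function.update_of_ne (by omega),
        Function.update_of_ne (by omega), e1 a (by omega), f' a (by omega)]
    · simp (disch := omega) only [Function.update_of_ne, Function.update_self]
    · simp (disch := omega) only [Function.update_self]
      push_cast; ring
    · simp (disch := omega) only [Function.update_of_ne, Function.update_self]
    · simp (disch := omega) only [Function.update_of_ne]
      rw [e4 s hs, if_pos (by omega)]
  · have hb : ∀ r, ∀ q < c, stepRows w i (segRow h c X) r q = ⊥ := fun r q hq =>
      stepRows_bot_of w (fun q' hq' => if_neg (by omega)) q le_rfl
    refine ⟨fun _ _ => rfl, g21, fun r hr => ?_, fun s hs => ?_⟩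
    · rw [k3 r hr, add_zero]
      cases c with
      | zero => rfl
      | succ c =>
        rw [prevEntry, closeRow_bot_of w fun q hq => hb r q (by omega), enc_bot]
    · rw [f' _ (by omega), hY s hs]
      split_ifs with h'
      · rw [hb h _ (by omega), sup_bot_eq]
      · rfl
  · have : d + h - c ≤ k * h := by omega
    have := Nat.mul_le_mul_right (h * 72 + 25 + 2) this
    have e : h * 72 + 25 + 2 = 72 * h + 27 := by ring
    rw [e] at this ⊢
    omega

/-! ### The main loop -/

/-- The end of one half of the iteration at the level with the record at address `M[10]`: continue
with the second half, with the first half of the next iteration, or, after the last iteration, with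
the end of an iteration at the next level. -/
def carry : Cmd :=
  .op [.load 13 10] ;;
    .ifLE 1 13
      (.op [.store 10 0, .add 14 10 1, .load 15 14, .add 15 15 4, .add 24 14 1, .add 25 24 4] ;;
        clearLoop ;;
        .ifLE 5 15 (.op [.store 14 0, .add 10 10 6, .add 11 11 11])
          (.op [.store 14 15, .sub 12 12 11, .const 10 32]))
      (.op [.store 10 1, .const 10 32])

/-- The body of the main loop. -/
def mainBody : Cmd := .ifLE 8 10 carry leaf

/-- The main loop. -/
def mainLoop : Cmd := .whileLT 10 7 mainBody

theorem mainBody_first_half (E : Env w S W M B h k l) {μ : ℕ → ℤ} (hC : Consts m n h k l μ)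
    {a : ℕ} (h10 : μ 10 = a) (ha : 34 + h ≤ a) (haS : a + (h + 2) ≤ S) (hμa : μ a = 0)
    {Q : (ℕ → ℤ) → Prop}
    (hQ : ∀ μ' : ℕ → ℤ, (∀ b, b ≠ 10 → b ≠ 13 → b ≠ a → μ' b = μ b) → μ' 10 = 32 → μ' a = 1 →
      Q μ') :
    Ok w S W mainBody μ (4 * h + 20) Q := by
  have hS := E.le_S
  have hSB := E.S_lt
  have hL : levelAddr h 1 = 34 + h := by simp only [levelAddr]; omega
  refine Ok.ifLE (by omega) (by omega) (4 * h + 18) (by omega) (fun _ => ?_) fun hlt => ?_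
  · refine Ok.op_seq hS (by decide) 4 (by simp) ?_
    refine wpList_load a h10 (by omega) hμa ?_
    refine Ok.ifLE (by omega) (by omega) 2 (by omega) (fun hle => ?_) fun _ => ?_
    · simp (disch := omega) only [Function.update_of_ne, Function.update_self, hC.one] at hle
      omega
    refine Ok.op hS (by decide) (by simp) ?_
    refine wpList_store a (v := 1) ?_ (by omega) ?_ (wpList_const (E.fits _ (by omega) (by omega))
      (hQ _ (fun b hb hb' hb'' => ?_) ?_ ?_))
    all_goals
      simp (disch := omega) only [Function.update_of_ne, Function.update_self, hC.one, h10]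
  · rw [hC.first_eq, h10, hL] at hlt
    omega

theorem mainBody_second_half (E : Env w S W M B h k l) {μ : ℕ → ℤ} (hC : Consts m n h k l μ)
    {a c i e : ℕ} (h10 : μ 10 = a) (ha : 34 + h ≤ a) (haS : a + (h + 2) ≤ S)
    (haS' : a + (h + 2) + (h + 2) ≤ S) (hμa : μ a = 1)
    (hc : μ (a + 1) = c) (hcK : c + h ≤ k * h) (h11 : μ 11 = e) (he : e ≤ 2 * (k * h))
    (h12 : μ 12 = (i + e : ℕ)) (hi : i + e ≤ k * h)
    {Q : (ℕ → ℤ) → Prop}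
    (hQ : ∀ μ' : ℕ → ℤ, (∀ b, b < 10 ∨ (32 ≤ b ∧ (b < a ∨ a + (h + 2) ≤ b)) → μ' b = μ b) →
      μ' a = 0 → (∀ s < h, μ' (a + 2 + s) = 0) →
      (c + h < k * h → μ' 10 = 32 ∧ μ' 12 = i ∧ μ' (a + 1) = (c + h : ℕ)) →
      (c + h = k * h → μ' 10 = (a + (h + 2) : ℕ) ∧ μ' 11 = (2 * e : ℕ) ∧ μ' 12 = (i + e : ℕ) ∧
        μ' (a + 1) = 0) →
      Q μ') :
    Ok w S W mainBody μ (4 * h + 20) Q := by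
  have hS := E.le_S
  have hSB := E.S_lt
  have hKB := E.K_lt
  have hL : levelAddr h 1 = 34 + h := by simp only [levelAddr]; omega
  have h0 := hC.zero
  have h1 := hC.one
  have h4 := hC.h_eq
  have h5 := hC.K_eq
  have h6 := hC.g_eq
  refine Ok.ifLE (by omega) (by omega) (4 * h + 18) (by omega) (fun _ => ?_) fun hlt => ?_
  · refine Ok.op_seq hS (by decide) (4 * h + 15) (by simp; omega) ?_
    refine wpList_load a h10 (by omega) hμa ?_
    refine Ok.ifLE (by omega) (by omega) (4 * h + 13) (by omega) (fun _ => ?_) fun hlt => ?_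
    · refine Ok.op_seq hS (by decide) (4 * h + 6) (by simp; omega) ?_
      refine wpList_store a (v := 0) ?_ (by omega) ?_ ?_
      any_goals simp (disch := omega) only [Function.update_of_ne, h0, h10]
      refine wpList_add (v := a + 1) ?_ (E.fits _ (by omega) (by omega)) ?_
      · simp (disch := omega) only [Function.update_of_ne, h1, h10]
      refine wpList_load (a + 1) (v := c) ?_ (by omega) ?_ ?_
      · simp (disch := omega) only [Function.update_self]
        simp
      · simp (disch := omega) only [Function.update_of_ne, hc]
      refine wpList_add (v := c + h) ?_ (E.fits _ (by omega) (by omega)) ?_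
      · simp (disch := omega) only [Function.update_of_ne, Function.update_self, h4]
      refine wpList_add (v := a + 2) ?_ (E.fits _ (by omega) (by omega)) ?_
      · simp (disch := omega) only [Function.update_of_ne, Function.update_self, h1]
        ring
      refine wpList_add (v := a + 2 + h) ?_ (E.fits _ (by omega) (by omega)) ?_
      · simp (disch := omega) only [Function.update_of_ne, Function.update_self, h4]
      refine Ok.seq (4 * h + 1) 5 (by omega) ?_
      refine clearLoop_ok E (p := a + 2) (by omega) (by omega) ?_ ?_ ?_ ?_ fun μ₁ f1 k1 => ?_
      any_goals
        simp (disch := omega) only [Function.update_of_ne, Function.update_self, h0, h1,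
          Nat.cast_add, Nat.cast_ofNat]
      have r14 : μ₁ 14 = (a + 1 : ℕ) := by
        rw [f1 _ (by omega) (by omega)]
        simp (disch := omega) only [Function.update_of_ne, Function.update_self]
        simp
      have r15 : μ₁ 15 = (c + h : ℕ) := by
        rw [f1 _ (by omega) (by omega)]
        simp (disch := omega) only [Function.update_of_ne, Function.update_self]
        simp
      have ra : μ₁ a = 0 := by
        rw [f1 _ (by omega) (by omega)]
        simp (disch := omega) only [Function.update_of_ne, Function.update_self]
      have f : ∀ b, b < 13 ∨ (32 ≤ b ∧ (b < a ∨ a + (h + 2) ≤ b)) → μ₁ b = μ b := fun b hb => by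
        rw [f1 _ (by omega) (by omega)]
        simp (disch := omega) only [Function.update_of_ne]
      clear f1
      refine Ok.ifLE (by omega) (by omega) 3 (by omega) (fun hle => ?_) fun hlt => ?_
      · rw [f 5 (by omega), h5, r15] at hle
        refine Ok.op hS (by decide) (by simp) ?_
        refine wpList_store (a + 1) r14 (by omega) ((f 0 (by omega)).trans h0) ?_
        refine wpList_add (v := (a + (h + 2) : ℕ)) ?_ (E.fits _ (by omega) (by omega)) ?_
        · simp (disch := omega) only [Function.update_of_ne, f, h10, h6]
          simp
        refine wpList_add (v := (2 * e : ℕ)) ?_ (E.fits _ (by omega) (by omega)) ?_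
        · simp (disch := omega) only [Function.update_of_ne, f, h11]
          omega
        refine hQ _ (fun b hb => ?_) ?_ (fun s hs => ?_) (fun _ => by omega)
          fun _ => ⟨?_, ?_, ?_, ?_⟩
        all_goals
          simp (disch := omega) only [Function.update_of_ne, Function.update_self, f, ra, k1, h12]
      · rw [f 5 (by omega), h5, r15] at hlt
        refine Ok.op hS (by decide) (by simp) ?_
        refine wpList_store (a + 1) r14 (by omega) r15 ?_
        refine wpList_sub (v := i) ?_ (E.fits _ (by omega) (by omega)) ?_
        · simp (disch := omega) only [Function.update_of_ne, f, h12, h11]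
          simp
        refine wpList_const (E.fits _ (by omega) (by omega)) ?_
        refine hQ _ (fun b hb => ?_) ?_ (fun s hs => ?_) (fun _ => ⟨?_, ?_, ?_⟩)
          fun _ => by omega
        all_goals
          simp (disch := omega) only [Function.update_of_ne, Function.update_self, f, ra, k1]
    · simp (disch := omega) only [Function.update_of_ne, Function.update_self, h1] at hlt
      omega
  · rw [hC.first_eq, h10, hL] at hlt
    omega

/-- A bound for the number of steps of the recursion at level `j`. -/
def mainTime (h k l : ℕ) : ℕ → ℕ
  | 0 => leafTime h k l + 4
  | j + 1 => k * (2 * mainTime h k l j + (8 * h + 44))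

/-- The configuration of the main loop in which the recursion at level `j` starts for the rows
`i, …, i + 2 ^ j * h`, with the source array `X` of level `jin` for the segment that starts in
column `c`, and the target array `Y` of level `jout` for the segment that starts in column `d`. -/
structure MainState (w : GridWeight m n) (M h k l j i jin jout c d : ℕ) (X Y : ℕ → WithBot ℤ)
    (μ : ℕ → ℤ) : Prop where
  consts : Consts m n h k l μ
  addr : μ 10 = 32
  row : μ 12 = i
  row_le : i + 2 ^ j * h ≤ k * h
  low : ∀ j', 1 ≤ j' → j' ≤ j → μ (levelAddr h j') = 0 ∧ μ (levelAddr h j' + 1) = 0 ∧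
    ∀ s < h, μ (levelAddr h j' + 2 + s) = 0
  lt_in : j < jin
  in_le : jin ≤ l + 2
  in_one : μ (levelAddr h jin) = 1
  in_zero : ∀ j', j < j' → j' < jin → μ (levelAddr h j') = 0
  lt_out : j < jout
  out_le : jout ≤ l + 2
  out_zero : μ (levelAddr h jout) = 0
  out_one : ∀ j', j < j' → j' < jout → μ (levelAddr h j') = 1
  source : μ (levelAddr h jin + 1) = c
  source_le : c + h ≤ k * h
  target : μ (levelAddr h jout + 1) = d
  target_le : d + h ≤ k * h
  source_row : ∀ s < h, μ (levelAddr h jin + 2 + s) = enc (X s)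
  target_row : ∀ s < h, μ (levelAddr h jout + 2 + s) = enc (Y s)
  bound : ∀ q : ℕ, AbsLE (M * (i + q)) (segRow h c X q)

/-- The configuration of the main loop in which the recursion of `MainState` has ended. -/
structure MainDone (w : GridWeight m n) (h j i jout c d : ℕ) (X Y : ℕ → WithBot ℤ)
    (μ μ' : ℕ → ℤ) : Prop where
  frame : ∀ a, a < 10 ∨ (34 + h ≤ a ∧ ¬ (levelAddr h jout + 2 ≤ a ∧ a < levelAddr h (jout + 1))) →
    μ' a = μ a
  addr : μ' 10 = levelAddr h (j + 1)
  pow : μ' 11 = (2 ^ (j + 1) * h : ℕ)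
  row : μ' 12 = (i + 2 ^ j * h : ℕ)
  target_row : ∀ s < h, μ' (levelAddr h jout + 2 + s) =
    enc (Y s ⊔ stepRows w i (segRow h c X) (2 ^ j * h) (d + s))

/-- The contribution of the paths through the segment `c'` of row `i + t` to the lengths of the
longest paths from row `i` to row `i + t + t`. -/
def viaSegment (w : GridWeight m n) (h i t : ℕ) (x : ℕ → WithBot ℤ) (c' q : ℕ) : WithBot ℤ :=
  stepRows w (i + t) (segRow h (c' * h) fun s => stepRows w i x t (c' * h + s)) t q

/-- The main loop carries out the recursion at level `j`, and then continues at level `j + 1`. The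
statement is in continuation-passing style, as the recursion is a part of one execution of
the loop. -/
theorem mainLoop_ok (E : Env w S W M B h k l) {j : ℕ} (hj : j ≤ l) {i jin jout c d : ℕ}
    {X Y : ℕ → WithBot ℤ} {μ : ℕ → ℤ} (H : MainState w M h k l j i jin jout c d X Y μ) {t : ℕ}
    {Q : (ℕ → ℤ) → Prop}
    (hQ : ∀ μ', MainDone w h j i jout c d X Y μ μ' → Ok w S W mainLoop μ' t Q) :
    Ok w S W mainLoop μ (mainTime h k l j + t) Q := by
  have hS := E.le_S
  induction j generalizing i jin jout c d X Y μ t with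
  | zero =>
    have hL := levelAddr_ge (h := h) (j := 1) le_rfl
    have hL' := levelAddr_ge (h := h) (j := l + 1) (by omega)
    have hrow := H.row_le
    rw [pow_zero, one_mul] at hrow
    refine Ok.while_true (by omega) (by omega) (leafTime h k l + 2) t
      (by simp only [mainTime]; omega) (by rw [H.addr, H.consts.end_eq]; omega) ?_
    refine Ok.ifLE (by omega) (by omega) (leafTime h k l) le_rfl (fun hle => ?_) fun _ => ?_
    · rw [H.addr, H.consts.first_eq] at hle
      omega
    refine leaf_ok E H.consts H.row hrow H.lt_in H.in_le H.in_one
      (fun j h1 h2 => H.in_zero j h1 h2) H.lt_out H.out_le H.out_zero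
      (fun j h1 h2 => H.out_one j h1 h2) H.source H.source_le H.target H.target_le H.source_row
      H.target_row H.bound fun μ' f h10 h11 h12 hy => hQ μ' ⟨f, h10, ?_, ?_, ?_⟩
    · simpa using h11
    · simpa using h12
    · simpa using hy
  | succ j ih =>
    -- the state before the iteration with the middle segment `e` at level `j + 1`
    suffices loop : ∀ s ≤ k, ∀ μ₁ : ℕ → ℤ,
        (∀ a, a < 10 ∨ (34 + h ≤ a ∧
          ¬ (levelAddr h jout + 2 ≤ a ∧ a < levelAddr h (jout + 1)) ∧
          a ≠ levelAddr h (j + 1) + 1) → μ₁ a = μ a) →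
        0 < s → μ₁ 10 = 32 → μ₁ 12 = i → μ₁ (levelAddr h (j + 1) + 1) = ((k - s) * h : ℕ) →
        (∀ r < h, μ₁ (levelAddr h jout + 2 + r) = enc (Y r ⊔ (Finset.range (k - s)).sup fun e =>
          viaSegment w h i (2 ^ j * h) (segRow h c X) e (d + r))) →
        Ok w S W mainLoop μ₁ (s * (2 * mainTime h k l j + (8 * h + 44)) + t) Q by
      have hk : 0 < k := by
        have := E.n_lt
        by_contra hk
        have : k = 0 := by omega
        subst this
        omega
      refine loop k le_rfl μ (fun _ _ => rfl) hk H.addr H.row ?_ fun r hr => ?_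
      · rw [(H.low (j + 1) (by omega) le_rfl).2.1]; simp
      · rw [H.target_row r hr]; simp
    intro s hs
    induction s with
    | zero => intro μ₁ _ h0; omega
    | succ s ihs =>
      intro μ₁ f _ h10 h12 hc' hy
      -- the index of the middle segment
      obtain ⟨e, he⟩ : ∃ e, e = k - (s + 1) := ⟨_, rfl⟩
      have hek : e + 1 + s = k := by omega
      rw [← he] at hc' hy
      have heh : e * h + h ≤ k * h := by
        rw [← Nat.succ_mul]; exact Nat.mul_le_mul_right _ (by omega)
      have hlt_in := H.lt_in
      have hlt_out := H.lt_out
      have hin_le := H.in_le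
      have hout_le := H.out_le
      have hrow : i + 2 ^ j * h + 2 ^ j * h ≤ k * h := by
        have := H.row_le
        rw [pow_succ, mul_assoc, two_mul, mul_add] at this
        omega
      have hne : jin ≠ jout := fun h => by
        have h1 := H.in_one; rw [h, H.out_zero] at h1; omega
      have g0 := levelAddr_ge (h := h) (j := j + 1) (by omega)
      have g1 : ∀ j', levelAddr h (j' + 1) = levelAddr h j' + (h + 2) := levelAddr_succ
      have g2 : ∀ j', j + 1 < j' → levelAddr h (j + 1) + (h + 2) ≤ levelAddr h j' :=
        fun j' hj' => levelAddr_lt hj'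
      have g3 : ∀ j', 1 ≤ j' → j' < j + 1 →
          34 + h ≤ levelAddr h j' ∧ levelAddr h j' + (h + 2) ≤ levelAddr h (j + 1) :=
        fun j' h1 h2 => ⟨levelAddr_ge h1, levelAddr_lt h2⟩
      have g4 : ∀ j', 1 ≤ j' → j' ≤ l + 2 → j' ≠ jout → 34 + h ≤ levelAddr h j' ∧
          (levelAddr h j' + (h + 2) ≤ levelAddr h jout ∨
            levelAddr h jout + (h + 2) ≤ levelAddr h j') := by
        intro j' h1 h2 h3
        refine ⟨levelAddr_ge h1, ?_⟩
        rcases lt_or_gt_of_ne h3 with h' | h'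
        · exact .inl (levelAddr_lt h')
        · exact .inr (levelAddr_lt h')
      have g5 := E.levelAddr_le (j := jout) H.out_le
      have g6 := levelAddr_lt (h := h) (i := j + 1) (j := l + 2) (by omega)
      have g7 := E.levelAddr_le (j := l + 2) le_rfl
      have gout := g2 jout (by omega)
      have gin := g2 jin (by omega)
      have gio := (g4 jin (by omega) H.in_le hne).2
      have hC₁ : Consts m n h k l μ₁ := H.consts.congr fun a ha => f a (by omega)
      have hend : levelAddr h (j + 1) < levelAddr h (l + 1) := by
        have := levelAddr_lt (h := h) (i := j + 1) (j := l + 1) (by omega)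
        omega
      obtain ⟨low1, -, low3⟩ := H.low (j + 1) (by omega) le_rfl
      rw [g1 jout] at f
      -- the paths from the source to the middle segment
      have first := ih (by omega) (i := i) (jin := jin) (jout := j + 1) (c := c) (d := e * h)
        (X := X) (Y := fun _ => ⊥) (μ := μ₁)
        (t := 4 * h + 22 + (mainTime h k l j + (4 * h + 22 +
          (s * (2 * mainTime h k l j + (8 * h + 44)) + t))))
        { consts := hC₁
          addr := h10
          row := h12
          row_le := by omega
          low := fun j' h1 h2 => by
            have g := g3 j' h1 (by omega)
            obtain ⟨l1, l2, l3⟩ := H.low j' h1 (by omega)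
            exact ⟨by rw [f _ (by omega), l1], by rw [f _ (by omega), l2],
              fun r hr => by rw [f _ (by omega), l3 r hr]⟩
          lt_in := by omega
          in_le := H.in_le
          in_one := by rw [f _ (by omega), H.in_one]
          in_zero := fun j' h1 h2 => by
            by_cases hj' : j' = j + 1
            · rw [hj', f _ (by omega), low1]
            · have g := g2 j' (by omega)
              by_cases hj'' : j' = jout
              · rw [hj'', f _ (by omega), H.out_zero]
              · have g' := g4 j' (by omega) (by omega) hj''
                rw [f _ (by omega), H.in_zero j' (by omega) h2]
          lt_out := by omega
          out_le := by omega
          out_zero := by rw [f _ (by omega), low1]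
          out_one := fun j' h1 h2 => by omega
          source := by rw [f _ (by omega), H.source]
          source_le := H.source_le
          target := hc'
          target_le := heh
          source_row := fun r hr => by rw [f _ (by omega), H.source_row r hr]
          target_row := fun r hr => by rw [f _ (by omega), low3 r hr, enc_bot]
          bound := H.bound }
      refine (first fun μ₂ D₂ => ?_).mono (by
        have := add_one_mul s (2 * mainTime h k l j + (8 * h + 44))
        omega) fun _ => id
      obtain ⟨f₂, b10, -, b12, by'⟩ := D₂
      rw [g1 (j + 1)] at f₂
      have hC₂ : Consts m n h k l μ₂ := hC₁.congr fun a ha => f₂ a (by omega)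
      refine Ok.while_true (by omega) (by omega) (4 * h + 20) (mainTime h k l j + (4 * h + 22 +
          (s * (2 * mainTime h k l j + (8 * h + 44)) + t))) (by omega)
        (by rw [b10, hC₂.end_eq]; omega) ?_
      refine mainBody_first_half E hC₂ b10 g0 (by omega)
        (by rw [f₂ _ (by omega), f _ (by omega), low1]) fun μ₃ f₃ c10 c1 => ?_
      -- the common frame of the first half of the iteration
      have f' : ∀ a, a < 10 ∨ (34 + h ≤ a ∧
          ¬ (levelAddr h (j + 1) ≤ a ∧ a < levelAddr h (j + 1) + (h + 2))) → μ₃ a = μ₁ a :=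
        fun a ha => by rw [f₃ a (by omega) (by omega) (by omega), f₂ a (by omega)]
      have hC₃ : Consts m n h k l μ₃ := hC₁.congr fun a ha => f' a (by omega)
      have hrows := stepRows_absLE E.ext_le H.bound (2 ^ j * h)
      -- the paths from the middle segment to the target
      refine ih (by omega) (i := i + 2 ^ j * h) (jin := j + 1) (jout := jout) (c := e * h) (d := d)
        (X := fun r => stepRows w i (segRow h c X) (2 ^ j * h) (e * h + r)) (μ := μ₃)
        { consts := hC₃
          addr := c10
          row := by rw [f₃ _ (by omega) (by omega) (by omega), b12]
          row_le := by omega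
          low := fun j' h1 h2 => by
            have g := g3 j' h1 (by omega)
            obtain ⟨l1, l2, l3⟩ := H.low j' h1 (by omega)
            exact ⟨by rw [f' _ (by omega), f _ (by omega), l1],
              by rw [f' _ (by omega), f _ (by omega), l2],
              fun r hr => by rw [f' _ (by omega), f _ (by omega), l3 r hr]⟩
          lt_in := by omega
          in_le := by omega
          in_one := c1
          in_zero := fun j' h1 h2 => by omega
          lt_out := by omega
          out_le := H.out_le
          out_zero := by rw [f' _ (by omega), f _ (by omega), H.out_zero]
          out_one := fun j' h1 h2 => by
            by_cases hj' : j' = j + 1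
            · rw [hj', c1]
            · have g := g2 j' (by omega)
              have g' := g4 j' (by omega) (by omega) (by omega)
              rw [f' _ (by omega), f _ (by omega), H.out_one j' (by omega) h2]
          source := by
            rw [f₃ _ (by omega) (by omega) (by omega), f₂ _ (by omega), hc']
          source_le := heh
          target := by rw [f' _ (by omega), f _ (by omega), H.target]
          target_le := H.target_le
          source_row := fun r hr => by
            rw [f₃ _ (by omega) (by omega) (by omega), by' r hr, bot_sup_eq]
          target_row := fun r hr => by rw [f' _ (by omega), hy r hr]
          bound := fun q => by
            rw [segRow]
            split_ifs with hq
            · have := hrows q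
              rwa [show e * h + (q - e * h) = q by omega]
            · exact absLE_bot _ } fun μ₄ D₄ => ?_
      obtain ⟨f₄, d10, d11, d12, dy⟩ := D₄
      rw [g1 jout] at f₄
      have hC₄ : Consts m n h k l μ₄ := hC₃.congr fun a ha => f₄ a (by omega)
      refine Ok.while_true (by omega) (by omega) (4 * h + 20)
        (s * (2 * mainTime h k l j + (8 * h + 44)) + t) (by omega)
        (by rw [d10, hC₄.end_eq]; omega) ?_
      have hpow : 2 ^ (j + 1) * h = 2 ^ j * h + 2 ^ j * h := by rw [pow_succ]; ring
      refine mainBody_second_half E hC₄ (c := e * h) (i := i) (e := 2 ^ (j + 1) * h) d10 g0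
        (by omega)
        (by have := E.levelAddr_le (j := j + 2) (by omega); rw [g1 (j + 1)] at this; omega)
        (by rw [f₄ _ (by omega), c1])
        (by rw [f₄ _ (by omega), f₃ _ (by omega) (by omega) (by omega), f₂ _ (by omega), hc'])
        heh d11 (by omega) (by rw [d12, hpow]; push_cast; ring) (by omega)
        fun μ₅ f₅ u0 ur u1 u2 => ?_
      have fr : ∀ a, a < 10 ∨ (34 + h ≤ a ∧
          ¬ (levelAddr h jout + 2 ≤ a ∧ a < levelAddr h jout + (h + 2)) ∧
          ¬ (levelAddr h (j + 1) ≤ a ∧ a < levelAddr h (j + 1) + (h + 2))) → μ₅ a = μ a :=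
        fun a ha => by
          rw [f₅ a (by omega), f₄ a (by omega), f' a (by omega), f a (by omega)]
      have fr' : ∀ a, a < 10 ∨ (34 + h ≤ a ∧
          ¬ (levelAddr h jout + 2 ≤ a ∧ a < levelAddr h jout + (h + 2)) ∧
          a ≠ levelAddr h (j + 1) + 1) → μ₅ a = μ a := by
        intro a ha
        by_cases h' : levelAddr h (j + 1) ≤ a ∧ a < levelAddr h (j + 1) + (h + 2)
        · by_cases h'' : a = levelAddr h (j + 1)
          · rw [h'', u0, low1]
          · obtain ⟨r, hr⟩ : ∃ r, a = levelAddr h (j + 1) + 2 + r :=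
              ⟨a - (levelAddr h (j + 1) + 2), by omega⟩
            rw [hr, ur r (by omega), low3 r (by omega)]
        · exact fr a (by omega)
      have hy₅ : ∀ r < h, μ₅ (levelAddr h jout + 2 + r) =
          enc (Y r ⊔ (Finset.range (e + 1)).sup fun e =>
            viaSegment w h i (2 ^ j * h) (segRow h c X) e (d + r)) := by
        intro r hr
        rw [f₅ _ (by omega), dy r hr, Finset.range_add_one, Finset.sup_insert,
          sup_assoc, sup_comm (Finset.sup _ _)]
        rfl
      by_cases hlast : e + 1 = k
      · have hs0 : s = 0 := by omega
        subst hs0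
        obtain ⟨v10, v11, v12, v1⟩ := u2 (by rw [← hlast, Nat.succ_mul])
        rw [Nat.zero_mul, Nat.zero_add]
        refine hQ μ₅ ⟨fun a ha => ?_, ?_, ?_, ?_, fun r hr => ?_⟩
        · rw [g1 jout] at ha
          by_cases h' : a = levelAddr h (j + 1) + 1
          · rw [h', v1, (H.low (j + 1) (by omega) le_rfl).2.1]
          · exact fr' a (by omega)
        · rw [v10, g1 (j + 1)]
        · rw [v11, pow_succ 2 (j + 1)]; push_cast; ring
        · exact v12
        · rw [hy₅ r hr, hlast, hpow, stepRows_add]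
          congr 2
          exact (stepRows_segments w h _ _ _ k _ (by have := H.target_le; omega)).symm
      · have hlt : e * h + h < k * h := by
          rw [← Nat.succ_mul]
          exact Nat.mul_lt_mul_of_pos_right (by omega) E.h_pos
        obtain ⟨v10, v12, v1⟩ := u1 hlt
        have hks : k - s = e + 1 := by omega
        rw [hks, g1 jout] at ihs
        exact ihs (by omega) μ₅ fr' (by omega) v10 v12 (by rw [v1, Nat.succ_mul]) hy₅

/-! ### Initialization and output -/

/-- The computation of the number `l` of levels in word `11` and of `k = 2 ^ l` in word `12`. For
`i` in word `11`, word `14` holds `2 ^ (i + 1) ^ 2`, and the loop stops when this exceeds `N`. -/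
def initLevels : Cmd :=
  .op [.const 1 1, .readM 2, .readN 3] ;; .ifLE 2 3 (.op [.add 10 3 0]) (.op [.add 10 2 0]) ;;
    .op [.add 15 10 1, .const 12 1, .const 14 2] ;;
    .whileLT 14 15 (.op [.add 12 12 12, .add 11 11 1, .mul 14 14 12, .mul 14 14 12, .add 14 14 14])

/-- The computation of the constants of the main loop. -/
def initConsts : Cmd :=
  .op [.div 4 10 12, .add 4 4 1, .mul 5 12 4, .const 13 2, .add 6 4 13, .const 9 34, .const 14 32,
    .add 8 14 6, .mul 7 11 6, .add 7 7 8]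

/-- The initialization of the records of the source and of the target. -/
def initRecords : Cmd :=
  .op [.store 7 1, .add 13 7 13, .store 13 1, .add 13 7 6, .add 13 13 1, .div 14 3 4, .mul 14 14 4,
    .store 13 14, .const 10 32, .add 12 0 0]

/-- The result is decoded to word `13`, unless it is `-∞`, which is indicated by the value `1` of
word `15`. -/
def decodeResult : Cmd :=
  .op [.add 13 7 6, .const 14 2, .add 13 13 14, .add 13 13 3, .div 15 3 4, .mul 15 15 4,
    .sub 13 13 15, .load 13 13] ;;
    .ifEq 13 0 (.op [.const 15 1]) (.op [.const 15 0]) ;; .op [.div 13 13 14]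

theorem initLevels_ok (hS : 32 ≤ S) {N : ℕ} (hN : N = max m n)
    (fits : ∀ x : ℤ, -B < x → x < B → x.bitLength ≤ W) (hNB : 2 * N ^ 3 + 2 < B)
    (hl : 2 ^ l ^ 2 ≤ N) (hl' : N < 2 ^ (l + 1) ^ 2) {Q : (ℕ → ℤ) → Prop}
    (hQ : ∀ μ : ℕ → ℤ, (∀ a, 32 ≤ a → μ a = 0) → μ 0 = 0 → μ 1 = 1 → μ 2 = m → μ 3 = n →
      μ 10 = N → μ 11 = l → μ 12 = (2 ^ l : ℕ) → Q μ) :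
    Ok w S W initLevels (fun _ => 0) (7 * l + 12) Q := by
  have hN3 : N ≤ N ^ 3 := Nat.le_self_pow (by omega) N
  have hN1 : 1 ≤ N := le_trans Nat.one_le_two_pow hl
  have hNB' : (2 : ℤ) * N + 2 < B := by
    have : (N : ℤ) ≤ (N : ℤ) ^ 3 := by exact_mod_cast hN3
    linarith
  refine Ok.op_seq hS (by decide) (7 * l + 9) (by simp; omega) ?_
  refine wpList_const (fits _ (by omega) (by omega)) ⟨fits _ (by omega) (by omega), ?_⟩
  refine ⟨fits _ (by omega) (by omega), ?_⟩
  refine Ok.seq 3 (7 * l + 6) (by omega) ?_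
  have main : ∀ μ : ℕ → ℤ, (∀ a, a = 0 ∨ 11 ≤ a → μ a = 0) → μ 1 = 1 → μ 2 = m → μ 3 = n →
      μ 10 = N → Ok w S W (.op [.add 15 10 1, .const 12 1, .const 14 2] ;;
        .whileLT 14 15 (.op [.add 12 12 12, .add 11 11 1, .mul 14 14 12, .mul 14 14 12,
          .add 14 14 14])) μ (7 * l + 6) Q := by
    intro μ f h1 h2 h3 h10
    refine Ok.op_seq hS (by decide) (7 * l + 3) (by simp; omega) ?_
    refine wpList_add (v := (N + 1 : ℕ)) ?_ (fits _ (by omega) (by omega)) (wpList_const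
      (fits _ (by omega) (by omega)) (wpList_const (fits _ (by omega) (by omega)) ?_))
    · rw [h10, h1]; simp
    refine Ok.for (by omega) (by omega)
      (fun i μ' => (∀ a, a < 11 ∨ 32 ≤ a → μ' a = μ a) ∧ μ' 11 = i ∧ μ' 12 = (2 ^ i : ℕ) ∧
        μ' 14 = (2 ^ (i + 1) ^ 2 : ℕ) ∧ μ' 15 = (N + 1 : ℕ)) l 5 ?_ ?_ ?_ (by omega)
    · rintro i hi μ' ⟨e1, e2, e3, e4, e5⟩
      have hiN : 2 ^ (i + 1) ^ 2 ≤ N :=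
        le_trans (Nat.pow_le_pow_right (by omega) (Nat.pow_le_pow_left (by omega) 2)) hl
      refine ⟨by rw [e4, e5]; omega, ?_⟩
      have hk : 2 ^ (i + 1) ≤ N :=
        le_trans (Nat.pow_le_pow_right (by omega) (Nat.le_self_pow (by omega) _)) hiN
      have hk1 : 1 ≤ 2 ^ (i + 1) := Nat.one_le_two_pow
      have hp : 2 ^ (i + 1 + 1) ^ 2 =
          2 * (2 ^ (i + 1) ^ 2 * 2 ^ (i + 1) * 2 ^ (i + 1)) := by
        rw [← pow_add, ← pow_add, ← pow_succ']; congr 1; ring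
      have hb1 : 2 ^ (i + 1) ^ 2 * 2 ^ (i + 1) ≤ 2 ^ (i + 1) ^ 2 * 2 ^ (i + 1) * 2 ^ (i + 1) :=
        Nat.le_mul_of_pos_right _ (by omega)
      have hb2 : 2 ^ (i + 1) ^ 2 * 2 ^ (i + 1) * 2 ^ (i + 1) ≤ N ^ 3 := by
        calc _ ≤ N * N * N := Nat.mul_le_mul (Nat.mul_le_mul hiN hk) hk
          _ = N ^ 3 := by ring
      have hb3 : (2 : ℤ) * (N ^ 3 : ℕ) + 2 < B := by exact_mod_cast hNB
      have hil : i < N := lt_of_lt_of_le (by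
        have := @Nat.lt_two_pow_self (i + 1)
        omega) hk
      refine Ok.op hS (by decide) (by simp) ?_
      refine wpList_add (v := (2 ^ (i + 1) : ℕ)) ?_ (fits _ (by omega) (by omega)) ?_
      · rw [e3, pow_succ]; push_cast; ring
      refine wpList_add (v := (i + 1 : ℕ)) ?_ (fits _ (by omega) (by omega)) ?_
      · simp (disch := omega) only [Function.update_of_ne, e1, e2, h1]
        simp
      refine wpList_mul (v := (2 ^ (i + 1) ^ 2 * 2 ^ (i + 1) : ℕ)) ?_
        (fits _ (by omega) (by omega)) ?_
      · simp (disch := omega) only [Function.update_of_ne, Function.update_self, e4]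
        simp
      refine wpList_mul (v := (2 ^ (i + 1) ^ 2 * 2 ^ (i + 1) * 2 ^ (i + 1) : ℕ)) ?_
        (fits _ (by omega) (by omega)) ?_
      · simp (disch := omega) only [Function.update_of_ne, Function.update_self]
        simp
      refine wpList_add (v := (2 ^ (i + 1 + 1) ^ 2 : ℕ)) ?_ (fits _ (by omega) (by omega)) ?_
      · simp (disch := omega) only [Function.update_self]
        rw [hp]; push_cast; ring
      refine ⟨fun a ha => ?_, ?_, ?_, ?_, ?_⟩
      all_goals
        simp (disch := omega) only [Function.update_of_ne, Function.update_self, e1, e5]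
    · rintro μ' ⟨e1, e2, e3, e4, e5⟩
      exact ⟨by rw [e4, e5]; omega, hQ μ' (fun a ha => by rw [e1 a (by omega), f a (by omega)])
        (by rw [e1 _ (by omega), f _ (by omega)]) (by rw [e1 _ (by omega), h1])
        (by rw [e1 _ (by omega), h2]) (by rw [e1 _ (by omega), h3])
        (by rw [e1 _ (by omega), h10]) e2 e3⟩
    · refine ⟨fun a ha => ?_, ?_, ?_, ?_, ?_⟩
      all_goals
        simp (disch := omega) only [Function.update_of_ne, Function.update_self, f]
      all_goals simp
  refine Ok.ifLE (by omega) (by omega) 1 (by omega) (fun hle => ?_) fun hlt => ?_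
  · simp (disch := omega) only [Function.update_of_ne, Function.update_self] at hle
    refine Ok.op hS (by decide) (by simp) (wpList_add (v := N) ?_ (fits _ (by omega) (by omega))
      (main _ (fun a ha => ?_) ?_ ?_ ?_ ?_))
    all_goals simp (disch := omega) only [Function.update_of_ne, Function.update_self]
    omega
  · simp (disch := omega) only [Function.update_of_ne, Function.update_self] at hlt
    refine Ok.op hS (by decide) (by simp) (wpList_add (v := N) ?_ (fits _ (by omega) (by omega))
      (main _ (fun a ha => ?_) ?_ ?_ ?_ ?_))
    all_goals simp (disch := omega) only [Function.update_of_ne, Function.update_self]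
    omega

theorem initConsts_ok (E : Env w S W M B h k l) {N : ℕ} (hkh : N / k + 1 = h) (hkpos : 0 < k)
    {μ : ℕ → ℤ} (h0 : μ 0 = 0) (h1 : μ 1 = 1) (h2 : μ 2 = m) (h3 : μ 3 = n) (h10 : μ 10 = N)
    (h11 : μ 11 = l) (h12 : μ 12 = k) {Q : (ℕ → ℤ) → Prop}
    (hQ : ∀ μ' : ℕ → ℤ, (∀ a, 32 ≤ a → μ' a = μ a) → Consts m n h k l μ' → μ' 13 = 2 → Q μ') :
    Ok w S W initConsts μ 10 Q := by
  have hS := E.le_S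
  have hSB := E.S_lt
  have hKB := E.K_lt
  have hh := E.h_pos
  have hhk : h ≤ k * h := Nat.le_mul_of_pos_left h hkpos
  have hL := E.levelAddr_le (j := 1) (by omega)
  have hL1 : levelAddr h 1 = 32 + (h + 2) := by simp [levelAddr]
  have hL2 := E.levelAddr_le (j := l + 1) (by omega)
  have hL3 : levelAddr h (l + 1) = l * (h + 2) + levelAddr h 1 := by
    simp only [levelAddr]; ring
  refine Ok.op hS (by decide) (by simp) ?_
  refine wpList_div h10 h12 (by omega) (v := (N / k : ℕ)) ?_ (E.fits _ (by omega) (by omega)) ?_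
  · rw [Int.fdiv_eq_ediv_of_nonneg _ (by omega)]; simp
  refine wpList_add (v := h) ?_ (E.fits _ (by omega) (by omega)) ?_
  · simp (disch := omega) only [Function.update_of_ne, Function.update_self, h1]
    omega
  refine wpList_mul (v := (k * h : ℕ)) ?_ (E.fits _ (by omega) (by omega)) ?_
  · simp (disch := omega) only [Function.update_of_ne, Function.update_self, h12]
    simp
  refine wpList_const (E.fits _ (by omega) (by omega)) ?_
  refine wpList_add (v := (h + 2 : ℕ)) ?_ (E.fits _ (by omega) (by omega)) ?_
  · simp (disch := omega) only [Function.update_of_ne, Function.update_self]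
    simp
  refine wpList_const (E.fits _ (by omega) (by omega)) ?_
  refine wpList_const (E.fits _ (by omega) (by omega)) ?_
  refine wpList_add (v := levelAddr h 1) ?_ (E.fits _ (by omega) (by omega)) ?_
  · simp (disch := omega) only [Function.update_of_ne, Function.update_self]
    omega
  refine wpList_mul (v := (l * (h + 2) : ℕ)) ?_ (E.fits _ (by omega) (by omega)) ?_
  · simp (disch := omega) only [Function.update_of_ne, Function.update_self, h11]
    simp
  refine wpList_add (v := levelAddr h (l + 1)) ?_ (E.fits _ (by omega) (by omega)) ?_
  · simp (disch := omega) only [Function.update_of_ne, Function.update_self]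
    omega
  refine hQ _ (fun a ha => ?_) ⟨?_, ?_, ?_, ?_, ?_, ?_, ?_, ?_, ?_, ?_⟩ ?_
  all_goals
    simp (disch := omega) only [Function.update_of_ne, Function.update_self, h0, h1, h2, h3,
      Nat.cast_ofNat]

theorem initRecords_ok (E : Env w S W M B h k l) (hk : k = 2 ^ l) {μ : ℕ → ℤ}
    (hC : Consts m n h k l μ) (hμ : ∀ a, 32 ≤ a → μ a = 0) (h13 : μ 13 = 2)
    {Q : (ℕ → ℤ) → Prop}
    (hQ : ∀ μ' : ℕ → ℤ,
      MainState w M h k l l 0 (l + 1) (l + 2) 0 (n / h * h) sourceRow (fun _ => ⊥) μ' → Q μ') :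
    Ok w S W initRecords μ 10 Q := by
  have hS := E.le_S
  have hSB := E.S_lt
  have hKB := E.K_lt
  have hh := E.h_pos
  have g1 := levelAddr_ge (h := h) (j := l + 1) (by omega)
  have g2 : levelAddr h (l + 2) = levelAddr h (l + 1) + (h + 2) := levelAddr_succ (l + 1)
  have g3 := E.levelAddr_le (j := l + 2) le_rfl
  have hdn := Nat.div_mul_le_self n h
  have hnK := E.n_lt
  have hdn' : n / h ≤ n := Nat.div_le_self n h
  have hdK : n / h * h + h ≤ k * h := by
    rw [← Nat.succ_mul]
    exact Nat.mul_le_mul_right _ (Nat.div_lt_of_lt_mul (by rwa [mul_comm]))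
  have hfd : (n : ℤ).fdiv h = (n / h : ℕ) := by
    rw [Int.fdiv_eq_ediv_of_nonneg _ (by omega)]; simp
  generalize n / h = d at *
  obtain ⟨h0, h1, h2, h3, h4, h5, h6, h7, h8, h9⟩ := id hC
  refine Ok.op hS (by decide) (by simp) ?_
  refine wpList_store _ h7 (by omega) h1 ?_
  refine wpList_add (v := (levelAddr h (l + 1) + 2 : ℕ)) ?_ (E.fits _ (by omega) (by omega)) ?_
  · simp (disch := omega) only [Function.update_of_ne, h7, h13]
    simp
  refine wpList_store (levelAddr h (l + 1) + 2) (v := 1) ?_ (by omega) ?_ ?_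
  · simp (disch := omega) only [Function.update_self]
  · simp (disch := omega) only [Function.update_of_ne, h1]
  refine wpList_add (v := levelAddr h (l + 2)) ?_ (E.fits _ (by omega) (by omega)) ?_
  · simp (disch := omega) only [Function.update_of_ne, h7, h6]
    omega
  refine wpList_add (v := (levelAddr h (l + 2) + 1 : ℕ)) ?_ (E.fits _ (by omega) (by omega)) ?_
  · simp (disch := omega) only [Function.update_of_ne, Function.update_self, h1]
    simp
  refine wpList_div (x := n) (y := h) ?_ ?_ (by omega) (v := d) ?_
    (E.fits _ (by omega) (by omega)) ?_
  · simp (disch := omega) only [Function.update_of_ne, h3]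
  · simp (disch := omega) only [Function.update_of_ne, h4]
  · exact hfd
  refine wpList_mul (v := (d * h : ℕ)) ?_ (E.fits _ (by omega) (by omega)) ?_
  · simp (disch := omega) only [Function.update_of_ne, Function.update_self, h4]
    simp
  refine wpList_store (levelAddr h (l + 2) + 1) (v := (d * h : ℕ)) ?_ (by omega) ?_ ?_
  any_goals simp (disch := omega) only [Function.update_of_ne, Function.update_self]
  refine wpList_const (E.fits _ (by omega) (by omega)) ?_
  refine wpList_add (v := 0) ?_ (E.fits _ (by omega) (by omega)) ?_
  · simp (disch := omega) only [Function.update_of_ne, h0]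
    simp
  have hlow : ∀ j', 1 ≤ j' → j' ≤ l → 34 + h ≤ levelAddr h j' ∧
      levelAddr h j' + (h + 2) ≤ levelAddr h (l + 1) := fun j' h1 h2 =>
    ⟨levelAddr_ge h1, levelAddr_lt (by omega)⟩
  refine hQ _
    { consts := hC.congr fun a ha => ?_
      addr := ?_
      row := ?_
      row_le := by rw [hk]; omega
      low := fun j' h1 h2 => ?_
      lt_in := by omega
      in_le := by omega
      in_one := ?_
      in_zero := fun j' h1 h2 => by omega
      lt_out := by omega
      out_le := le_rfl
      out_zero := ?_
      out_one := fun j' h1 h2 => ?_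
      source := ?_
      source_le := by omega
      target := ?_
      target_le := hdK
      source_row := fun s hs => ?_
      target_row := fun s hs => ?_
      bound := fun q => ?_ }
  case refine_4 =>
    have g := hlow j' h1 h2
    refine ⟨?_, ?_, fun s hs => ?_⟩
    all_goals
      simp (disch := omega) only [Function.update_of_ne, hμ]
  case refine_7 =>
    obtain rfl : j' = l + 1 := by omega
    simp (disch := omega) only [Function.update_of_ne, Function.update_self]
  case refine_10 =>
    by_cases hs0 : s = 0
    · subst hs0
      simp (disch := omega) only [Function.update_of_ne, Function.update_self, add_zero]
      rfl
    · simp (disch := omega) only [Function.update_of_ne, hμ]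
      rw [sourceRow, if_neg hs0, enc_bot]
  case refine_12 =>
    rw [segRow]
    split_ifs
    · rw [sourceRow]
      split_ifs
      · intro v hv
        rw [← WithBot.coe_zero, WithBot.coe_inj] at hv
        rw [← hv, abs_zero]
        positivity
      · exact absLE_bot _
    · exact absLE_bot _
  all_goals
    simp (disch := omega) only [Function.update_of_ne, Function.update_self, hμ, enc_bot,
      Nat.cast_zero]

theorem decodeResult_ok (E : Env w S W M B h k l) {μ : ℕ → ℤ} (hC : Consts m n h k l μ)
    {x : WithBot ℤ} (hx : μ (levelAddr h (l + 2) + 2 + (n - n / h * h)) = enc x)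
    {Q : (ℕ → ℤ) → Prop}
    (hQ : ∀ μ' : ℕ → ℤ, μ' 1 = 1 → (x = ⊥ → μ' 15 = 1) →
      (∀ v : ℤ, x = v → μ' 15 = 0 ∧ μ' 13 = v) → Q μ') :
    Ok w S W decodeResult μ 14 Q := by
  have hS := E.le_S
  have hSB := E.S_lt
  have hKB := E.K_lt
  have hh := E.h_pos
  have g1 := levelAddr_ge (h := h) (j := l + 2) (by omega)
  have g2 : levelAddr h (l + 2) = levelAddr h (l + 1) + (h + 2) := levelAddr_succ (l + 1)
  have g3 := E.levelAddr_le (j := l + 2) le_rfl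
  have hdn := Nat.div_mul_le_self n h
  have hdn' : n / h ≤ n := Nat.div_le_self n h
  have hnd : n - n / h * h < h := by
    have h1 := Nat.div_add_mod' n h
    have h2 := Nat.mod_lt n hh
    omega
  have hnK := E.n_lt
  have hfd : (n : ℤ).fdiv h = (n / h : ℕ) := by
    rw [Int.fdiv_eq_ediv_of_nonneg _ (by omega)]; simp
  generalize n / h = d at *
  obtain ⟨h0, h1, h2, h3, h4, h5, h6, h7, h8, h9⟩ := id hC
  refine Ok.assume fun hfit => ?_
  have hxfit := hfit (levelAddr h (l + 2) + 2 + (n - d * h))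
  rw [hx] at hxfit
  refine Ok.op_seq hS (by decide) 6 (by simp) ?_
  refine wpList_add (v := levelAddr h (l + 2)) (by omega) (E.fits _ (by omega) (by omega)) ?_
  refine wpList_const (E.fits _ (by omega) (by omega)) ?_
  refine wpList_add (v := (levelAddr h (l + 2) + 2 : ℕ)) ?_ (E.fits _ (by omega) (by omega)) ?_
  · simp (disch := omega) only [Function.update_of_ne, Function.update_self]
    simp
  refine wpList_add (v := (levelAddr h (l + 2) + 2 + n : ℕ)) ?_
    (E.fits _ (by omega) (by omega)) ?_
  · simp (disch := omega) only [Function.update_of_ne, Function.update_self, h3]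
    simp
  refine wpList_div (x := n) (y := h) ?_ ?_ (by omega) (v := d) ?_
    (E.fits _ (by omega) (by omega)) ?_
  · simp (disch := omega) only [Function.update_of_ne, h3]
  · simp (disch := omega) only [Function.update_of_ne, h4]
  · exact hfd
  refine wpList_mul (v := (d * h : ℕ)) ?_ (E.fits _ (by omega) (by omega)) ?_
  · simp (disch := omega) only [Function.update_of_ne, Function.update_self, h4]
    simp
  refine wpList_sub (v := (levelAddr h (l + 2) + 2 + (n - d * h) : ℕ)) ?_
    (E.fits _ (by omega) (by omega)) ?_
  · simp (disch := omega) only [Function.update_of_ne, Function.update_self]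
    omega
  refine wpList_load (levelAddr h (l + 2) + 2 + (n - d * h)) (v := enc x) ?_ (by omega) ?_ ?_
  · simp (disch := omega) only [Function.update_self]
  · simp (disch := omega) only [Function.update_of_ne, hx]
  have last : ∀ u : ℤ, ∀ μ₁ : ℕ → ℤ, μ₁ 1 = 1 → μ₁ 13 = enc x → μ₁ 14 = 2 → μ₁ 15 = u →
      u = (if x = ⊥ then 1 else 0) → Ok w S W (.op [.div 13 13 14]) μ₁ 1 Q := by
    intro u μ₁ k1 k13 k14 k15 hu
    induction x using WithBot.recBotCoe with
    | bot =>
      refine Ok.op hS (by decide) (by simp) (wpList_div k13 k14 (by omega) (v := 0) (by simp)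
        (E.fits _ (by omega) (by omega)) (hQ _ ?_ (fun _ => ?_) fun v hv => by simp at hv))
      · simp (disch := omega) only [Function.update_of_ne, k1]
      · simp (disch := omega) only [Function.update_of_ne, k15, hu, if_true]
    | coe z =>
      have hdiv : (2 * z + 1).fdiv 2 = z := by
        rw [Int.fdiv_eq_ediv_of_nonneg _ (by omega)]; omega
      refine Ok.op hS (by decide) (by simp) (wpList_div k13 k14 (by omega) (v := z) hdiv
        ?_ (hQ _ ?_ (fun hb => by simp at hb) fun v hv => ?_))
      · refine le_trans ?_ hxfit
        rw [enc_coe, Int.bitLength, Int.bitLength]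
        have : z.natAbs.size ≤ (2 * z + 1).natAbs.size := Nat.size_le_size (by omega)
        omega
      · simp (disch := omega) only [Function.update_of_ne, k1]
      · rw [WithBot.coe_inj] at hv
        simp (disch := omega) only [Function.update_of_ne, Function.update_self, k15, hu, hv]
        simp
  refine Ok.seq 5 1 (by omega) ?_
  refine Ok.ifEq (by omega) (by omega) 1 le_rfl (fun heq => ?_) fun hne => ?_
  · simp (disch := omega) only [Function.update_of_ne, Function.update_self, h0, enc_eq_zero] at heq
    refine Ok.op hS (by decide) (by simp) (wpList_const (E.fits _ (by omega) (by omega))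
      (last 1 _ ?_ ?_ ?_ ?_ (by rw [if_pos heq])))
    all_goals simp (disch := omega) only [Function.update_of_ne, Function.update_self, h1]
  · simp (disch := omega) only [Function.update_of_ne, Function.update_self, h0, ne_eq,
      enc_eq_zero] at hne
    refine Ok.op hS (by decide) (by simp) (wpList_const (E.fits _ (by omega) (by omega))
      (last 0 _ ?_ ?_ ?_ ?_ (by rw [if_neg hne])))
    all_goals simp (disch := omega) only [Function.update_of_ne, Function.update_self, h1]

/-! ### The program -/

/-- The structured part of the program. -/
def mainCmd : Cmd := initLevels ;; initConsts ;; initRecords ;; mainLoop ;; decodeResult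

/-- The program for the RAM. -/
def longestPathProgram : RAMProgram :=
  mainCmd.code 0 ++ [.jumpLE 1 15 (mainCmd.len + 2), .outInt 13, .outBot]


theorem mainCmd_ok (E : Env w S W M B h k l) {N : ℕ} (hN : N = max m n) (hk : k = 2 ^ l)
    (hkh : N / k + 1 = h) (hNB : 2 * N ^ 3 + 2 < B) (hl : 2 ^ l ^ 2 ≤ N)
    (hl' : N < 2 ^ (l + 1) ^ 2) {Q : (ℕ → ℤ) → Prop}
    (hQ : ∀ μ' : ℕ → ℤ, μ' 1 = 1 → (longest w m n = ⊥ → μ' 15 = 1) →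
      (∀ v : ℤ, longest w m n = v → μ' 15 = 0 ∧ μ' 13 = v) → Q μ') :
    Ok w S W mainCmd (fun _ => 0) (mainTime h k l l + 7 * l + 47) Q := by
  have hk0 : 0 < k := hk ▸ Nat.two_pow_pos l
  have hnK := E.n_lt
  have hmK := E.m_lt
  have hnd : n / h * h + (n - n / h * h) = n := by
    have := Nat.div_mul_le_self n h
    omega
  have hndh : n - n / h * h < h := by
    have h1 := Nat.div_add_mod' n h
    have h2 := Nat.mod_lt n E.h_pos
    omega
  refine Ok.seq (7 * l + 12) (mainTime h k l l + 35) (by omega) ?_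
  refine initLevels_ok E.le_S hN E.fits hNB hl hl' fun μ₁ f h0 h1 h2 h3 h10 h11 h12 => ?_
  refine Ok.seq 10 (mainTime h k l l + 25) (by omega) ?_
  refine initConsts_ok E hkh hk0 h0 h1 h2 h3 h10 h11 (by rw [h12, hk]) fun μ₂ f₂ hC₂ h13 => ?_
  refine Ok.seq 10 (mainTime h k l l + 15) (by omega) ?_
  refine initRecords_ok E hk hC₂ (fun a ha => by rw [f₂ a ha, f a ha]) h13 fun μ₃ H => ?_
  refine Ok.seq (mainTime h k l l + 1) 14 (by omega) ?_
  have hC₃ := H.consts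
  refine mainLoop_ok E le_rfl H fun μ₄ D => ?_
  have hC₄ : Consts m n h k l μ₄ := hC₃.congr fun a ha => D.frame a (by omega)
  have hS := E.le_S
  refine Ok.while_false (by omega) (by omega) le_rfl (by rw [D.addr, hC₄.end_eq]) ?_
  refine decodeResult_ok E hC₄ (x := longest w m n) ?_ hQ
  rw [D.target_row _ hndh, hnd, bot_sup_eq, ← hk]
  have hseg : segRow h 0 sourceRow = sourceRow := by
    funext q
    rw [segRow]
    split_ifs with hq
    · rfl
    · rw [sourceRow, if_neg]
      have := E.h_pos
      omega
  rw [hseg, ← stepRows_last w (k * h - (m + 1)), show m + 1 + (k * h - (m + 1)) = k * h by omega]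

theorem longestPathProgram_computes (E : Env w S W M B h k l) {N : ℕ} (hN : N = max m n)
    (hk : k = 2 ^ l) (hkh : N / k + 1 = h) (hNB : 2 * N ^ 3 + 2 < B) (hl : 2 ^ l ^ 2 ≤ N)
    (hl' : N < 2 ^ (l + 1) ^ 2) :
    ∃ T ≤ mainTime h k l l + 7 * l + 49,
      longestPathProgram.Computes w S W T (longest w m n) := by
  have hS := E.le_S
  have hSB := E.S_lt
  obtain ⟨s, hs, μ, -, ⟨h1, hbot, hcoe⟩, hr⟩ := mainCmd_ok E hN hk hkh hNB hl hl'
    (Q := fun μ' => μ' 1 = 1 ∧ (longest w m n = ⊥ → μ' 15 = 1) ∧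
      ∀ v : ℤ, longest w m n = v → μ' 15 = 0 ∧ μ' 13 = v)
    (fun μ' h1 h2 h3 => ⟨h1, h2, h3⟩) (fun _ => E.fits 0 (by omega) (by omega))
    longestPathProgram 0 ⟨[], _, rfl, rfl⟩
  refine ⟨s + 2, by omega, ?_⟩
  have hlen := mainCmd.length_code 0
  have p0 : longestPathProgram[mainCmd.len]? = some (.jumpLE 1 15 (mainCmd.len + 2)) := by
    rw [longestPathProgram, ← hlen]; simp
  have p1 : longestPathProgram[mainCmd.len + 1]? = some (.outInt 13) := by
    rw [longestPathProgram, ← hlen]; simp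
  have p2 : longestPathProgram[mainCmd.len + 2]? = some .outBot := by
    rw [longestPathProgram, ← hlen]; simp
  have hj := reaches_jumpLE (w := w) (S := S) (W := W) (μ := μ) (by omega) (by omega) p0
  rw [RAMProgram.Computes, RAMConfig.init, hr 2, zero_add, hj 1, h1]
  generalize longest w m n = x at *
  induction x using WithBot.recBotCoe with
  | bot =>
    rw [hbot rfl, if_pos le_rfl]
    simp [RAMProgram.run, RAMProgram.step, p2, RAMInstr.exec]
  | coe v =>
    obtain ⟨h15, h13⟩ := hcoe v rfl
    rw [h15, if_neg (by omega)]
    simp [RAMProgram.run, RAMProgram.step, p1, RAMInstr.exec, RAMConfig.read,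
      show 13 < S by omega, h13]

/-! ### Bounds for time and space -/

/-- The recursion at level `j` processes `(2 * k) ^ j` strips, and the other work takes at most as
many steps as `leaf`. The summand on the left makes the induction work. -/
theorem mainTime_le (hk : 0 < k) (hh : 0 < h) (j : ℕ) :
    mainTime h k l j + (leafTime h k l + 4) ≤ 2 * (2 * k) ^ j * (leafTime h k l + 4) := by
  have hkh : 1 ≤ k * h := Nat.mul_pos hk hh
  have hA : 8 * h + 44 ≤ leafTime h k l + 4 := by
    simp only [leafTime]
    nlinarith
  induction j with
  | zero => simp only [mainTime, pow_zero]; omega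
  | succ j ih =>
    generalize leafTime h k l + 4 = A at *
    rw [mainTime]
    have e : 2 * (2 * k) ^ (j + 1) * A = k * (2 * (2 * (2 * k) ^ j * A)) := by
      rw [pow_succ]; ring
    rw [e]
    generalize 2 * (2 * k) ^ j * A = D at *
    nlinarith [Nat.mul_le_mul_left k ih, Nat.mul_le_mul_left k hA, Nat.mul_le_mul_right A hk]

theorem mainTime_le_cube {N : ℕ} (hk : k = 2 ^ l) (hkh : N / k + 1 = h) (hl : 2 ^ l ^ 2 ≤ N) :
    mainTime h k l l + 7 * l + 49 ≤ 2000 * N ^ 3 := by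
  have hk0 : 0 < k := hk ▸ Nat.two_pow_pos l
  have hN0 : 0 < N := lt_of_lt_of_le (Nat.two_pow_pos _) hl
  have hlk : l ≤ k := hk ▸ Nat.lt_two_pow_self.le
  have hkN : k ≤ N := by
    refine le_trans ?_ hl
    rw [hk]
    exact Nat.pow_le_pow_right (by omega) (Nat.le_self_pow (by omega) l)
  have hKN : k * h ≤ 2 * N := by
    rw [← hkh, mul_add, mul_one]
    have := Nat.mul_div_le N k
    omega
  have hh : 0 < h := hkh ▸ Nat.succ_pos _
  have hA : leafTime h k l + 4 ≤ 200 * (k * h * h) := by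
    have h1 : k ≤ k * h := Nat.le_mul_of_pos_right k hh
    have h2 : k * h ≤ k * h * h := Nat.le_mul_of_pos_right _ hh
    have h3 : h ≤ k * h := Nat.le_mul_of_pos_left h hk0
    simp only [leafTime]
    have e : k * h * (72 * h + 27) = 72 * (k * h * h) + 27 * (k * h) := by ring
    rw [e]
    omega
  have hpow : (2 * k) ^ l ≤ k * N := by
    rw [mul_pow, ← hk]
    refine Nat.mul_le_mul_left _ (le_trans (le_of_eq ?_) hl)
    rw [hk, ← pow_mul, sq]
  have h1 := mainTime_le (l := l) hk0 hh l
  have h2 : 2 * (2 * k) ^ l * (leafTime h k l + 4) ≤ 1600 * N ^ 3 :=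
    calc 2 * (2 * k) ^ l * (leafTime h k l + 4) ≤ 2 * (k * N) * (200 * (k * h * h)) := by gcongr
      _ = 400 * N * (k * h) ^ 2 := by ring
      _ ≤ 400 * N * (2 * N) ^ 2 := by gcongr
      _ = 1600 * N ^ 3 := by ring
  have h3 : N ≤ N ^ 3 := Nat.le_self_pow (by omega) N
  omega

theorem ext_absLE {b : ℝ} (hw : w.FitsIn b) (d : GridDir) (i j : ℕ) :
    AbsLE (2 ^ ⌊b⌋₊ : ℕ) (w.ext d i j) := by
  intro v hv
  by_cases hij : i + d.di ≤ m ∧ j + d.dj ≤ n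
  · have he := ext_of_edge w (u := ⟨⟨i, by omega⟩, ⟨j, by omega⟩⟩)
      (v := ⟨⟨i + d.di, by omega⟩, ⟨j + d.dj, by omega⟩⟩) ⟨d, rfl, rfl⟩ rfl rfl
    have hb := hw _ _ _ v (he.symm.trans hv)
    have hs : v.natAbs.size ≤ ⌊b⌋₊ := Nat.le_floor (le_trans (by simp [Int.bitLength]) hb)
    rw [Int.abs_eq_natAbs]
    exact_mod_cast (Nat.size_le.mp hs).le
  · unfold GridWeight.ext at hv
    rw [if_neg hij] at hv
    cases d with
    | fst =>
      simp only at hv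
      rw [← WithBot.coe_zero, WithBot.coe_inj] at hv
      rw [← hv, abs_zero]
      positivity
    | snd => simp at hv
    | diag => simp at hv

theorem bitLength_le_of_lt {V : ℕ} {x : ℤ} (h₁ : -(2 ^ V : ℕ) < x) (h₂ : x < (2 ^ V : ℕ)) :
    x.bitLength ≤ 1 + V :=
  Nat.add_le_add_left (Nat.size_le.mpr (by omega)) 1

/-- The words of `1 + (F + 7 + 3 * (L + 1))` bits are large enough, where the weights have at most
`F` bits, and `N` at most `L + 1` bits. -/
theorem env_of_fitsIn {N F : ℕ} (hN : N = max m n) (hN2 : 2 ≤ N) (hk : k = 2 ^ l)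
    (hkh : N / k + 1 = h) (hl : 2 ^ l ^ 2 ≤ N)
    (hw : ∀ d i j, AbsLE (2 ^ F : ℕ) (w.ext d i j)) :
    Env w (32 + (l + 3) * (h + 2)) (1 + (F + 7 + 3 * (Nat.log 2 N + 1))) (2 ^ F)
      (2 ^ (F + 7 + 3 * (Nat.log 2 N + 1)) : ℕ) h k l ∧
    2 * (N : ℤ) ^ 3 + 2 < (2 ^ (F + 7 + 3 * (Nat.log 2 N + 1)) : ℕ) := by
  have hk0 : 0 < k := hk ▸ Nat.two_pow_pos l
  have hlk : l ≤ k := hk ▸ Nat.lt_two_pow_self.le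
  have hkN : k ≤ N := by
    refine le_trans ?_ hl
    rw [hk]
    exact Nat.pow_le_pow_right (by omega) (Nat.le_self_pow (by omega) l)
  have hKN : k * h ≤ 2 * N := by
    rw [← hkh, mul_add, mul_one]
    have := Nat.mul_div_le N k
    omega
  have hNK : N < k * h := by
    rw [← hkh]
    exact Nat.lt_mul_div_succ N hk0
  have hhN : h ≤ N + 1 := by
    rw [← hkh]
    exact Nat.succ_le_succ (Nat.div_le_self N k)
  have hB : 2 ^ F * 128 * N ^ 3 ≤ 2 ^ (F + 7 + 3 * (Nat.log 2 N + 1)) := by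
    rw [pow_add, pow_add, mul_comm 3, pow_mul]
    gcongr
    · norm_num
    · exact (Nat.lt_pow_succ_log_self (by omega) N).le
  have hF : 1 ≤ 2 ^ F := Nat.one_le_two_pow
  have hh : 0 < h := hkh ▸ Nat.succ_pos _
  generalize F + 7 + 3 * (Nat.log 2 N + 1) = V at hB ⊢
  have hN3 : 4 * N ≤ N ^ 3 := by
    have := Nat.mul_le_mul (Nat.mul_le_mul hN2 hN2) (le_refl N)
    calc 4 * N = 2 * 2 * N := by ring
      _ ≤ N * N * N := this
      _ = N ^ 3 := by ring
  have hN2' : N * N ≤ N ^ 3 := by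
    rw [← sq]; exact Nat.pow_le_pow_right (by omega) (by omega)
  have hFN : N ^ 3 ≤ 2 ^ F * N ^ 3 := Nat.le_mul_of_pos_left _ (by omega)
  have hFN' : 2 ^ F * N ≤ 2 ^ F * N ^ 3 :=
    Nat.mul_le_mul_left _ (Nat.le_self_pow (by omega) N)
  have hF2 : 2 ^ F * 2 ≤ 2 ^ F * N := Nat.mul_le_mul_left _ hN2
  have hB' : 128 * (2 ^ F * N ^ 3) ≤ 2 ^ V := le_trans (le_of_eq (by ring)) hB
  have hS : (l + 3) * (h + 2) ≤ N * N + 6 * N + 9 :=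
    calc (l + 3) * (h + 2) ≤ (N + 3) * (N + 3) := Nat.mul_le_mul (by omega) (by omega)
      _ = N * N + 6 * N + 9 := by ring
  have hv : 2 ^ F * (4 * (k * h) + 2) ≤ 8 * (2 ^ F * N) + 2 ^ F * 2 :=
    calc 2 ^ F * (4 * (k * h) + 2) ≤ 2 ^ F * (4 * (2 * N) + 2) := by gcongr
      _ = _ := by ring
  refine ⟨⟨le_rfl, ?_, fun x => bitLength_le_of_lt, hw, ?_, ?_, by omega, by omega, hh⟩, ?_⟩
  · have : 2 * (32 + (l + 3) * (h + 2)) < 2 ^ V := by omega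
    exact_mod_cast this
  · have : 2 ^ F * (4 * (k * h) + 2) + 1 < 2 ^ V := by omega
    exact_mod_cast this
  · have : 4 * (k * h) + 4 < 2 ^ V := by omega
    exact_mod_cast this
  · have : 2 * N ^ 3 + 2 < 2 ^ V := by omega
    exact_mod_cast this

/-- With `y = √(log N)`, the number of words is `O(y * N / 2 ^ y)`, each of
`O(y ^ 2)` bits. -/
theorem space_le {N : ℕ} (hN2 : 2 ≤ N) (hk : k = 2 ^ l) (hkh : N / k + 1 = h)
    (hl : 2 ^ l ^ 2 ≤ N) (hl' : N < 2 ^ (l + 1) ^ 2) {D W : ℝ} (hW0 : 0 ≤ W)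
    (hW : W ≤ D * Real.logb 2 N) :
    ((32 + (l + 3) * (h + 2) : ℕ) : ℝ) * W ≤ 52 * D * lcsSpace N := by
  have hN0 : (0 : ℝ) < N := by positivity
  have hlog1 : 1 ≤ Real.logb 2 N := by
    rw [Real.le_logb_iff_rpow_le (by norm_num) hN0, Real.rpow_one]
    exact_mod_cast hN2
  obtain ⟨y, hy⟩ : ∃ y, y = √(Real.logb 2 N) := ⟨_, rfl⟩
  have hy1 : 1 ≤ y := by rw [hy]; exact Real.one_le_sqrt.mpr hlog1
  have hy2 : Real.logb 2 N = y ^ 2 := by rw [hy, Real.sq_sqrt (by linarith)]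
  have hly : (l : ℝ) ≤ y := by
    rw [hy]
    refine Real.le_sqrt_of_sq_le ?_
    rw [Real.le_logb_iff_rpow_le (by norm_num) hN0, ← Nat.cast_pow, Real.rpow_natCast]
    exact_mod_cast hl
  have hyl : y ≤ l + 1 := by
    rw [hy]
    refine Real.sqrt_le_iff.mpr ⟨by positivity, ?_⟩
    rw [Real.logb_le_iff_le_rpow (by norm_num) hN0]
    have : (N : ℝ) ≤ 2 ^ (l + 1) ^ 2 := by exact_mod_cast hl'.le
    refine this.trans (le_of_eq ?_)
    rw [← Real.rpow_natCast]
    push_cast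
    rfl
  -- `Z` is the length of a segment, up to a constant factor
  obtain ⟨Z, hZ⟩ : ∃ Z : ℝ, Z = N / 2 ^ y := ⟨_, rfl⟩
  have hZ1 : 1 ≤ Z := by
    rw [hZ, le_div_iff₀ (by positivity), one_mul]
    calc (2 : ℝ) ^ y ≤ 2 ^ (y ^ 2) :=
          Real.rpow_le_rpow_of_exponent_le (by norm_num) (by nlinarith)
      _ = N := by rw [← hy2]; exact Real.rpow_logb (by norm_num) (by norm_num) hN0
  have hh : (h : ℝ) + 2 ≤ 5 * Z := by
    have h1 : ((N / k : ℕ) : ℝ) ≤ N / k := Nat.cast_div_le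
    have h2 : (N : ℝ) / k ≤ 2 * Z := by
      rw [hZ, ← mul_div_assoc, div_le_div_iff₀ (by rw [hk]; positivity) (by positivity)]
      have h3 : (2 : ℝ) ^ y ≤ 2 * k := by
        calc (2 : ℝ) ^ y ≤ 2 ^ ((l + 1 : ℕ) : ℝ) :=
              Real.rpow_le_rpow_of_exponent_le (by norm_num) (by exact_mod_cast hyl)
          _ = 2 * k := by rw [Real.rpow_natCast, pow_succ, hk]; push_cast; ring
      nlinarith
    rw [← hkh]
    push_cast
    linarith
  have hspace : lcsSpace N = Z * y ^ 3 := by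
    have h1 : (y ^ 2) ^ (1.5 : ℝ) = y ^ 3 := by
      rw [← Real.rpow_natCast, ← Real.rpow_mul (by linarith), ← Real.rpow_natCast]
      norm_num
    rw [lcsSpace, ← hy, hy2, h1, hZ]
    ring
  have hS : ((32 + (l + 3) * (h + 2) : ℕ) : ℝ) ≤ 52 * (y * Z) := by
    have h1 : ((l : ℝ) + 3) * (h + 2) ≤ (4 * y) * (5 * Z) := by
      refine mul_le_mul (by linarith) hh (by positivity) (by linarith)
    have h2 : 1 ≤ y * Z := one_le_mul_of_one_le_of_one_le hy1 hZ1
    push_cast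
    linarith
  rw [hy2] at hW
  calc ((32 + (l + 3) * (h + 2) : ℕ) : ℝ) * W ≤ 52 * (y * Z) * (D * y ^ 2) :=
        mul_le_mul hS hW hW0 (by positivity)
    _ = 52 * D * lcsSpace N := by rw [hspace]; ring

end Machine

theorem lemma2 :
    ∃ P : RAMProgram, ∀ c : ℝ, ∃ C : ℝ, ∀ (m n N : ℕ), N = max m n → 2 ≤ N →
      ∀ w : GridWeight m n, w.FitsIn (c * Real.logb 2 N) →
        ∃ x : WithBot ℤ,
          IsGreatest (w.pathLengths ⟨0, 0⟩ ⟨Fin.last m, Fin.last n⟩) x ∧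
          ∃ S W T : ℕ,
            P.Computes w S W T x ∧
            (W : ℝ) ≤ C * Real.logb 2 N ∧
            (T : ℝ) ≤ C * (N : ℝ) ^ 3 ∧
            ((S * W : ℕ) : ℝ) ≤ C * lcsSpace N := by
  refine ⟨longestPathProgram, fun c => ⟨2000 * (|c| + 14), fun m n N hN hN2 w hw =>
    ⟨longest w m n, isGreatest_longest w, ?_⟩⟩⟩
  have hN0 : (0 : ℝ) < N := by positivity
  have hlog1 : 1 ≤ Real.logb 2 N := by
    rw [Real.le_logb_iff_rpow_le (by norm_num) hN0, Real.rpow_one]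
    exact_mod_cast hN2
  have hc := abs_nonneg c
  -- the largest `l` with `2 ^ l ^ 2 ≤ N`
  obtain ⟨l, hl⟩ : ∃ l, l = Nat.sqrt (Nat.log 2 N) := ⟨_, rfl⟩
  have hl1 : 2 ^ l ^ 2 ≤ N := by
    rw [hl]
    exact (Nat.pow_le_pow_right (by omega) (Nat.sqrt_le' _)).trans
      (Nat.pow_log_le_self 2 (by omega))
  have hl2 : N < 2 ^ (l + 1) ^ 2 := by
    rw [hl]
    exact (Nat.lt_pow_succ_log_self (by omega) N).trans_le
      (Nat.pow_le_pow_right (by omega) (Nat.lt_succ_sqrt' _))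
  obtain ⟨E, hNB⟩ := env_of_fitsIn hN hN2 (k := 2 ^ l) (h := N / 2 ^ l + 1) rfl rfl hl1
    (ext_absLE hw)
  obtain ⟨T, hT, hcomp⟩ := longestPathProgram_computes E hN rfl rfl hNB hl1 hl2
  refine ⟨_, _, T, hcomp, ?_, ?_, ?_⟩
  all_goals
    have hWc : ((1 + (⌊c * Real.logb 2 N⌋₊ + 7 + 3 * (Nat.log 2 N + 1)) : ℕ) : ℝ) ≤
        (|c| + 14) * Real.logb 2 N := by
      have h1 : (⌊c * Real.logb 2 N⌋₊ : ℝ) ≤ |c| * Real.logb 2 N :=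
        (Nat.cast_le.mpr (Nat.floor_mono
          (mul_le_mul_of_nonneg_right (le_abs_self c) (by linarith)))).trans
          (Nat.floor_le (by positivity))
      have h2 : (Nat.log 2 N : ℝ) ≤ Real.logb 2 N := by
        rw [Real.le_logb_iff_rpow_le (by norm_num) hN0, Real.rpow_natCast]
        exact_mod_cast Nat.pow_log_le_self 2 (by omega)
      push_cast
      nlinarith
  · nlinarith
  · have hT' : T ≤ 2000 * N ^ 3 := hT.trans (mainTime_le_cube rfl rfl hl1)
    have hT'' : (T : ℝ) ≤ 2000 * (N : ℝ) ^ 3 := by exact_mod_cast hT'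
    have : (0 : ℝ) ≤ (N : ℝ) ^ 3 := by positivity
    nlinarith
  · have hsp := space_le hN2 (k := 2 ^ l) (h := N / 2 ^ l + 1) rfl rfl hl1 hl2
      (Nat.cast_nonneg _) hWc
    rw [Nat.cast_mul]
    refine hsp.trans ?_
    have : 0 ≤ lcsSpace N := by unfold lcsSpace; positivity
    nlinarith [mul_nonneg hc this]
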